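/- Let $\mathbb{H}=\{z\in\mathbb{C}:\Im z>0\}$. Let $H^2(\mathbb{H}^2)$ be the Hardy space of all analytic $f:\mathbb{H}^2\to\mathbb{C}$ with $$\sup_{y_1,y_2>0}\int_{\mathbb{R}^2}|f(x_1+iy_1,x_2+iy_2)|^2\,dx_1\,dx_2<\infty .$$ For a function $g$ on $\mathbb{H}^2$ and $x=(x_1,x_2)\in\mathbb{R}^2$ write $g^*(x)=\lim_{y\to0^+}g(x_1+iy,x_2+iy)$, whenever this limit exists in the (finite-dimensional complex) target space of $g$. Let $\varphi:\mathbb{H}^2\to\mathbb{H}^2$ be analytic and such that for almost every $x\in\mathbb{R}^2$ the boundary value $\varphi^*(x)=(\varphi_1^*(x),\varphi_2^*(x))\in\mathbb{C}^2$ exists and satisfies $\Im\varphi_1^*(x)>0$ and $\Im\varphi_2^*(x)>0$. Let $f\in H^2(\mathbb{H}^2)$ and $C_\varphi f=f\circ\varphi$. Then $f^*(t)$ exists for almost every $t\in\mathbb{R}^2$, and for almost every $x\in\mathbb{R}^2$ the boundary value $(C_\varphi f)^*(x)$ exists, the integral below converges absolutely, and $$(C_\varphi f)^*(x)=\lim_{y\to0^+}(C_\varphi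 f)(x_1+iy,x_2+iy)=\frac{1}{(2\pi i)^2}\int_{-\infty}^{\infty}\int_{-\infty}^{\infty}\frac{f^*(t_1,t_2)\,dt_1\,dt_2}{(t_1-\varphi_1^*(x))(t_2-\varphi_2^*(x))}.$$ -/

import Mathlib

open Filter Topology MeasureTheory

noncomputable section

/-- The point `x + i y` of `ℂ²`, for `x, y ∈ ℝ²`. -/
def tubePoint (x y : ℝ × ℝ) : ℂ × ℂ :=
  ((x.1 : ℂ) + (y.1 : ℂ) * Complex.I, (x.2 : ℂ) + (y.2 : ℂ) * Complex.I)

/-- The two-dimensional upper half-plane `ℍ² = ℍ × ℍ ⊆ ℂ²`. -/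
def biHalfPlane : Set (ℂ × ℂ) := {z | 0 < z.1.im ∧ 0 < z.2.im}

/-- The Hardy space `H²(ℍ²)` of the tubular domain `ℍ² = ℝ² ⊕ i (0, ∞)²`: the analytic functions
on `ℍ²` whose `L²` norms over the translates `ℝ² + i y`, `y ∈ (0, ∞)²`, are uniformly bounded.
(Elements are total functions of which only the restriction to `ℍ²` matters.) -/
def hardySpace : Set (ℂ × ℂ → ℂ) :=
  {f | AnalyticOnNhd ℂ f biHalfPlane ∧
    ∃ C : NNReal, ∀ y : ℝ × ℝ, 0 < y.1 → 0 < y.2 →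
      ∫⁻ x : ℝ × ℝ, ‖f (tubePoint x y)‖ₑ ^ 2 ≤ C}

/-- `g` has the boundary value `w` at `x ∈ ℝ²`: `g (x + i (y, y)) → w` as `y ↓ 0`. -/
def HasBoundaryValue {E : Type*} [TopologicalSpace E] (g : ℂ × ℂ → E) (x : ℝ × ℝ) (w : E) :
    Prop :=
  Tendsto (fun y : ℝ => g (tubePoint x (y, y))) (𝓝[>] 0) (𝓝 w)

/-- The boundary function `g*(x) = lim_{y ↓ 0} g (x + i (y, y))` (arbitrary where there is no
limit). -/
def boundaryFunction {E : Type*} [TopologicalSpace E] [Nonempty E] (g : ℂ × ℂ → E)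
    (x : ℝ × ℝ) : E :=
  limUnder (𝓝[>] (0 : ℝ)) (fun y : ℝ => g (tubePoint x (y, y)))

/-- The composition operator `C_φ f = f ∘ φ`. -/
def compositionOperator (φ : ℂ × ℂ → ℂ × ℂ) (f : ℂ × ℂ → ℂ) : ℂ × ℂ → ℂ := fun z => f (φ z)

/-- The two-variable Cauchy integrand `t ↦ g(t) / ((t₁ - w₁)(t₂ - w₂))`. -/
def cauchyIntegrand (g : ℝ × ℝ → ℂ) (w : ℂ × ℂ) (t : ℝ × ℝ) : ℂ :=
  g t / (((t.1 : ℂ) - w.1) * ((t.2 : ℂ) - w.2))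

/-- The two-variable Cauchy integral `(2πi)⁻² ∫∫ g(t) dt / ((t₁ - w₁)(t₂ - w₂))`. -/
def cauchyIntegral (g : ℝ × ℝ → ℂ) (w : ℂ × ℂ) : ℂ :=
  1 / (2 * (Real.pi : ℂ) * Complex.I) ^ 2 * ∫ t : ℝ × ℝ, cauchyIntegrand g w t

end

/-! For almost every x the point φ*(x) lies in the open domain, where f is continuous, so (C_φ
f)*(x) = f(φ*(x)). Everything reduces to two facts about f alone: f* exists almost everywhere
(`ae_hasBoundaryValue`), and f is the Cauchy integral of f* (`cauchyIntegral_boundaryFunction`).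

Boundary values: the approach x + i(y, y) stays in a complex line. With x = (s, s + c), it is the
vertical approach to s for the slice z ↦ f(z, z + c). The map (c, s) ↦ (s, s + c) preserves area and
L² means decrease with height, so monotone convergence puts almost every slice in the one-variable
Hardy space. There Fatou's theorem holds (`ae_exists_tendsto_vertical`): a weak-* limit of the
horizontal traces is an L² density whose Poisson integral is the slice, and Poisson integrals
converge at Lebesgue points.

Cauchy formula: the translate f(· + i(ε, ε)) is analytic past the boundary and, by the sub-mean
value property, bounded (`hardySpace_bounded`). The product Poisson kernel reproduces it. Each
factor is a difference of a Cauchy kernel and its conjugate, and every term containing a conjugate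
kernel integrates to zero (`integral_cauchyKernel_mul_eq`). As ε → 0 the translates are bounded in
L² and converge almost everywhere, hence weakly (`tendsto_integral_mul_of_ae_tendsto`); the Cauchy
kernel is in L², so the formula passes to the limit. -/

/-! ### Contour integration in the closed half-plane -/

/-- Compactness handles the bounded part of the closed half-plane. The outcome is a single global
majorant that serves both for integrability on the line and for estimates on contours. -/
theorem exists_le_div_one_add_sq {G : ℂ → ℂ} {K ρ : ℝ}
    (hc : ContinuousOn G {z | 0 ≤ z.im})
    (hK : ∀ z : ℂ, 0 ≤ z.im → ρ ≤ ‖z‖ → ‖G z‖ ≤ K / ‖z‖ ^ 2) :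
    ∃ C, 0 ≤ C ∧ ∀ z : ℂ, 0 ≤ z.im → ‖G z‖ ≤ C / (1 + ‖z‖ ^ 2) := by
  have hcpt : IsCompact (Metric.closedBall (0 : ℂ) (max ρ 1) ∩ {z | 0 ≤ z.im}) :=
    (isCompact_closedBall _ _).inter_right (isClosed_le continuous_const Complex.continuous_im)
  obtain ⟨B, hB⟩ := hcpt.exists_bound_of_continuousOn (hc.mono Set.inter_subset_right)
  refine ⟨max (|B| * (1 + (max ρ 1) ^ 2)) (2 * |K|), by positivity, fun z hz => ?_⟩
  rw [le_div_iff₀ (by positivity)]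
  rcases le_total ‖z‖ (max ρ 1) with h | h
  · refine le_trans ?_ (le_max_left _ _)
    have h1 := hB z ⟨by simpa using h, hz⟩
    have : ‖z‖ ^ 2 ≤ (max ρ 1) ^ 2 := by gcongr
    have := le_abs_self B
    gcongr
    linarith
  · refine le_trans ?_ (le_max_right _ _)
    have h1 := hK z hz (le_trans (le_max_left _ _) h)
    have h2 : 1 ≤ ‖z‖ := le_trans (le_max_right _ _) h
    have h3 : (1 : ℝ) ≤ ‖z‖ ^ 2 := one_le_pow₀ h2
    rw [le_div_iff₀ (by positivity)] at h1
    have := le_abs_self K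
    nlinarith [norm_nonneg (G z)]

/-- Cauchy's theorem on the closed upper half-plane for integrands decaying quadratically. -/
theorem integral_real_line_eq_zero {G : ℂ → ℂ} {K ρ : ℝ}
    (hd : DifferentiableOn ℂ G {z | 0 ≤ z.im})
    (hK : ∀ z : ℂ, 0 ≤ z.im → ρ ≤ ‖z‖ → ‖G z‖ ≤ K / ‖z‖ ^ 2) :
    Integrable (fun t : ℝ => G t) ∧ ∫ t : ℝ, G t = 0 := by
  obtain ⟨C, hC0, hC⟩ := exists_le_div_one_add_sq hd.continuousOn hK
  have hcont : Continuous fun t : ℝ => G t :=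
    hd.continuousOn.comp_continuous Complex.continuous_ofReal (fun t => by simp)
  have hint : Integrable (fun t : ℝ => G t) := by
    refine (integrable_inv_one_add_sq.const_mul C).mono' hcont.aestronglyMeasurable ?_
    refine Eventually.of_forall fun t => ?_
    have := hC t (by simp)
    simpa [div_eq_mul_inv] using this
  refine ⟨hint, ?_⟩
  have h1 : Tendsto (fun R : ℝ => ∫ t in (-R)..R, G t) atTop (𝓝 (∫ t : ℝ, G t)) :=
    intervalIntegral_tendsto_integral hint tendsto_neg_atTop_atBot tendsto_id
  have h2 : Tendsto (fun R : ℝ => ∫ t in (-R)..R, G t) atTop (𝓝 0) := by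
    -- On the rectangle [-R, R] × [0, R] the three sides off the real axis are at distance at least
    -- R from 0. The top contributes 2C/R and each vertical side C/R.
    have hlim : Tendsto (fun R : ℝ => 4 * C / R) atTop (𝓝 0) :=
      tendsto_const_nhds.div_atTop tendsto_id
    refine squeeze_zero_norm' ?_ hlim
    filter_upwards [eventually_gt_atTop 0] with R hR
    have hrect := Complex.integral_boundary_rect_eq_zero_of_differentiableOn G
      (-R : ℝ) (R + R * Complex.I) (hd.mono (by
        rintro z ⟨-, hz⟩
        have : z.im ∈ Set.uIcc (0 : ℝ) R := by simpa using hz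
        rw [Set.uIcc_of_le hR.le] at this
        exact this.1))
    have hbd : ∀ z : ℂ, 0 ≤ z.im → R ≤ ‖z‖ → ‖G z‖ ≤ C / R ^ 2 := fun z hz hRz => by
      refine (hC z hz).trans ?_
      have : R ^ 2 ≤ ‖z‖ ^ 2 := by gcongr
      gcongr
      linarith
    have hT : ‖∫ x in (-R)..R, G (x + R * Complex.I)‖ ≤ C / R ^ 2 * |R - -R| := by
      refine intervalIntegral.norm_integral_le_of_norm_le_const fun x _ => hbd _ (by simp [hR.le]) ?_
      refine le_trans ?_ (Complex.abs_im_le_norm _)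
      simp [le_abs_self]
    have hV : ∀ s : ℝ, R ≤ |s| →
        ‖∫ y in (0 : ℝ)..R, G (s + y * Complex.I)‖ ≤ C / R ^ 2 * |R - 0| := fun s hs => by
      refine intervalIntegral.norm_integral_le_of_norm_le_const fun y hy => ?_
      rw [Set.uIoc_of_le hR.le] at hy
      refine hbd _ (by simp [hy.1.le]) (le_trans ?_ (Complex.abs_re_le_norm _))
      simpa using hs
    have hV1 := hV R (le_abs_self _)
    have hV2 := hV (-R) (by simp [le_abs_self])
    simp at hrect hV2
    have e : ∫ t in (-R)..R, G t = (∫ x in (-R)..R, G (x + R * Complex.I))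
        - Complex.I * (∫ y in (0 : ℝ)..R, G (R + y * Complex.I))
        + Complex.I * (∫ y in (0 : ℝ)..R, G (-R + y * Complex.I)) := by
      linear_combination hrect
    rw [e]
    refine (norm_add_le _ _).trans ((add_le_add_left (norm_sub_le _ _) _).trans ?_)
    rw [norm_mul, norm_mul, Complex.norm_I, one_mul, one_mul]
    have e1 : C / R ^ 2 * |R - -R| = 2 * C / R := by
      rw [abs_of_pos (by linarith)]; field_simp; ring
    have e2 : C / R ^ 2 * |R - 0| = C / R := by
      rw [abs_of_pos (by linarith)]; field_simp; ring
    rw [e1] at hT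
    rw [e2] at hV1
    have e3 : C / R ^ 2 * |R| = C / R := by rw [← e2]; simp
    rw [e3] at hV2
    have : 4 * C / R = 2 * C / R + C / R + C / R := by ring
    linarith
  exact tendsto_nhds_unique h1 h2

/-! ### The Poisson and Cauchy kernels in one variable -/

/-- The Poisson kernel of the upper half-plane. -/
noncomputable def halfPlanePoisson (w : ℂ) (t : ℝ) : ℝ :=
  w.im / Real.pi * ((t - w.re) ^ 2 + w.im ^ 2)⁻¹

theorem halfPlanePoisson_nonneg {w : ℂ} (hw : 0 < w.im) (t : ℝ) : 0 ≤ halfPlanePoisson w t := by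
  unfold halfPlanePoisson; positivity

theorem continuous_halfPlanePoisson {w : ℂ} (hw : 0 < w.im) :
    Continuous (halfPlanePoisson w) := by
  unfold halfPlanePoisson
  refine continuous_const.mul (Continuous.inv₀ (by fun_prop) fun t => by positivity)

theorem halfPlanePoisson_eq {w : ℂ} (hw : 0 < w.im) (t : ℝ) :
    halfPlanePoisson w t = Real.pi⁻¹ * w.im⁻¹ * (1 + ((t - w.re) / w.im) ^ 2)⁻¹ := by
  unfold halfPlanePoisson
  have := hw.ne'
  field_simp
  ring

theorem integrable_halfPlanePoisson {w : ℂ} (hw : 0 < w.im) :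
    Integrable (halfPlanePoisson w) := by
  simp_rw [funext (halfPlanePoisson_eq hw)]
  exact ((integrable_inv_one_add_sq.comp_div hw.ne').comp_sub_right w.re).const_mul _

theorem integral_halfPlanePoisson {w : ℂ} (hw : 0 < w.im) :
    ∫ t, halfPlanePoisson w t = 1 := by
  simp_rw [halfPlanePoisson_eq hw]
  rw [integral_const_mul, integral_sub_right_eq_self (fun t : ℝ => (1 + (t / w.im) ^ 2)⁻¹) w.re,
    Measure.integral_comp_div (fun t : ℝ => (1 + t ^ 2)⁻¹), integral_univ_inv_one_add_sq,
    abs_of_pos hw]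
  have := hw.ne'
  simp
  field_simp

theorem ofReal_sub_ne_zero {w : ℂ} (hw : w.im ≠ 0) (t : ℝ) : (t : ℂ) - w ≠ 0 := by
  intro h
  have := congrArg Complex.im h
  simp at this
  exact hw this

theorem ofReal_sub_mul_sub_conj (w : ℂ) (t : ℝ) :
    ((t : ℂ) - w) * (t - (starRingEnd ℂ) w) = (((t - w.re) ^ 2 + w.im ^ 2 : ℝ) : ℂ) := by
  have : (t : ℂ) - (starRingEnd ℂ) w = (starRingEnd ℂ) (t - w) := by simp
  rw [this, Complex.mul_conj, Complex.normSq_apply]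
  congr 1
  simp
  ring

/-- This splitting is what turns Poisson formulas into Cauchy formulas. -/
theorem ofReal_halfPlanePoisson {w : ℂ} (hw : 0 < w.im) (t : ℝ) :
    (halfPlanePoisson w t : ℂ) =
      1 / (2 * Real.pi * Complex.I) * (1 / (t - w) - 1 / (t - (starRingEnd ℂ) w)) := by
  have h1 := ofReal_sub_ne_zero hw.ne' t
  have h2 : (t : ℂ) - (starRingEnd ℂ) w ≠ 0 := ofReal_sub_ne_zero (by simpa using hw.ne') t
  have h3 : ((t : ℂ) - w) * (t - (starRingEnd ℂ) w) = (((t - w.re) ^ 2 + w.im ^ 2 : ℝ) : ℂ) :=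
    ofReal_sub_mul_sub_conj w t
  have h4 : w - (starRingEnd ℂ) w = 2 * w.im * Complex.I := by
    apply Complex.ext <;> simp; ring
  have h5 : 1 / ((t : ℂ) - w) - 1 / (t - (starRingEnd ℂ) w) =
      (w - (starRingEnd ℂ) w) * (((t : ℂ) - w) * (t - (starRingEnd ℂ) w))⁻¹ := by
    field_simp; ring
  rw [h5, h3, h4, halfPlanePoisson]
  have := Complex.I_ne_zero
  have := Complex.ofReal_ne_zero.2 Real.pi_ne_zero
  push_cast
  field_simp

/-- The Poisson formula for bounded analytic functions on the closed upper half-plane. -/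
theorem integral_halfPlanePoisson_mul {h : ℂ → ℂ} {δ M : ℝ} (hδ : δ < 0)
    (hd : DifferentiableOn ℂ h {z | δ < z.im}) (hM : ∀ z : ℂ, 0 ≤ z.im → ‖h z‖ ≤ M)
    {w : ℂ} (hw : 0 < w.im) :
    ∫ t : ℝ, (halfPlanePoisson w t : ℂ) * h t = h w := by
  have hopen : IsOpen {z : ℂ | δ < z.im} := isOpen_lt continuous_const Complex.continuous_im
  have hsub : {z : ℂ | 0 ≤ z.im} ⊆ {z | δ < z.im} := fun z hz => lt_of_lt_of_le hδ hz
  have hM0 : 0 ≤ M := (norm_nonneg _).trans (hM w hw.le)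
  have hds : DifferentiableOn ℂ (dslope h w) {z | δ < z.im} :=
    (Complex.differentiableOn_dslope (hopen.mem_nhds (hδ.trans hw))).2 hd
  have hne : ∀ z : ℂ, 0 ≤ z.im → z - (starRingEnd ℂ) w ≠ 0 := fun z hz h0 => by
    have := congrArg Complex.im h0
    simp at this
    linarith
  -- The integrand is (h(z) - h(w)) / ((z - w)(z - w̄)): `dslope` removes the singularity at w, and
  -- w̄ lies outside. For ‖z‖ ≥ 2‖w‖ + 1 both factors of the denominator are at least ‖z‖/2, whence
  -- 8M.
  have key := integral_real_line_eq_zero (G := fun z => dslope h w z / (z - (starRingEnd ℂ) w))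
    (K := 8 * M) (ρ := 2 * ‖w‖ + 1)
    ((hds.mono hsub).div (by fun_prop) hne) (fun z hz hzr => by
      have hw0 := norm_nonneg w
      have hzw : z ≠ w := by
        rintro rfl
        linarith
      have h1 : ‖z‖ / 2 ≤ ‖z - w‖ := by
        have := norm_sub_norm_le z w
        linarith
      have h2 : ‖z‖ / 2 ≤ ‖z - (starRingEnd ℂ) w‖ := by
        have := norm_sub_norm_le z ((starRingEnd ℂ) w)
        rw [RCLike.norm_conj] at this
        linarith
      have hz0 : 0 < ‖z‖ := by linarith
      have h3 : ‖h z - h w‖ ≤ 2 * M := by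
        have := norm_sub_le (h z) (h w)
        have := hM z hz
        have := hM w hw.le
        linarith
      rw [dslope_of_ne _ hzw, slope_def_field, norm_div, norm_div, div_div]
      calc ‖h z - h w‖ / (‖z - w‖ * ‖z - (starRingEnd ℂ) w‖)
          ≤ 2 * M / (‖z‖ / 2 * (‖z‖ / 2)) := by gcongr
        _ = 8 * M / ‖z‖ ^ 2 := by field_simp; ring)
  have heq : ∀ t : ℝ, (halfPlanePoisson w t : ℂ) * h t =
      (w.im / Real.pi : ℂ) * (dslope h w t / (t - (starRingEnd ℂ) w))
        + (halfPlanePoisson w t : ℂ) * h w := fun t => by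
    have h1 := ofReal_sub_ne_zero hw.ne' t
    have h2 := hne t (by simp)
    have h3 : ((t : ℂ) - w) * (t - (starRingEnd ℂ) w) = (((t - w.re) ^ 2 + w.im ^ 2 : ℝ) : ℂ) :=
      ofReal_sub_mul_sub_conj w t
    rw [dslope_of_ne _ (sub_ne_zero.1 h1), slope_def_field, div_div, h3, halfPlanePoisson]
    push_cast
    ring
  simp_rw [heq]
  have hP : Integrable fun t : ℝ => (halfPlanePoisson w t : ℂ) * h w :=
    (integrable_halfPlanePoisson hw).ofReal.mul_const _
  rw [integral_add (key.1.const_mul _) hP,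
    integral_const_mul, key.2, mul_zero, zero_add, integral_mul_const, integral_complex_ofReal,
    integral_halfPlanePoisson hw]
  simp

theorem memLp_two_inv_ofReal_sub {w : ℂ} (hw : w.im ≠ 0) :
    MemLp (fun t : ℝ => 1 / ((t : ℂ) - w)) 2 := by
  have hcont : Continuous fun t : ℝ => 1 / ((t : ℂ) - w) :=
    continuous_const.div (by fun_prop) (ofReal_sub_ne_zero hw)
  rw [memLp_two_iff_integrable_sq_norm hcont.aestronglyMeasurable]
  have := ((integrable_inv_one_add_sq.comp_div hw).comp_sub_right w.re).const_mul (w.im ^ 2)⁻¹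
  refine this.congr (Eventually.of_forall fun t => ?_)
  have h1 : ‖(t : ℂ) - w‖ ^ 2 = (t - w.re) ^ 2 + w.im ^ 2 := by
    rw [← Complex.normSq_eq_norm_sq, Complex.normSq_apply]; simp; ring
  simp only [norm_div, norm_one, div_pow, h1, one_pow]
  field_simp
  ring

/-- The conjugate Cauchy kernel annihilates square integrable boundary values. -/
theorem integral_div_sub_conj_eq_zero {h : ℂ → ℂ} {δ M : ℝ} (hδ : δ < 0)
    (hd : DifferentiableOn ℂ h {z | δ < z.im}) (hM : ∀ z : ℂ, 0 ≤ z.im → ‖h z‖ ≤ M)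
    (hL : MemLp (fun t : ℝ => h t) 2) {w : ℂ} (hw : 0 < w.im) :
    ∫ t : ℝ, 1 / ((t : ℂ) - (starRingEnd ℂ) w) * h t = 0 := by
  have hcw : ((starRingEnd ℂ) w).im ≠ 0 := by simpa using hw.ne'
  have hsub : {z : ℂ | 0 ≤ z.im} ⊆ {z | δ < z.im} := fun z hz => lt_of_lt_of_le hδ hz
  have hM0 : 0 ≤ M := (norm_nonneg _).trans (hM w hw.le)
  have hne : ∀ z : ℂ, 0 ≤ z.im → z - (starRingEnd ℂ) w ≠ 0 := fun z hz h0 => by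
    have := congrArg Complex.im h0
    simp at this
    linarith
  have hI : Integrable fun t : ℝ => 1 / ((t : ℂ) - (starRingEnd ℂ) w) * h t :=
    (memLp_two_inv_ofReal_sub hcw).integrable_mul hL
  have hnA : ∀ A : ℝ, 0 < A → ∀ z : ℂ, 0 ≤ z.im → A ≤ ‖z + A * Complex.I‖ := fun A hA z hz => by
    have := Complex.abs_im_le_norm (z + A * Complex.I)
    simp at this
    exact (by linarith : A ≤ z.im + A).trans ((le_abs_self _).trans this)
  -- With h merely bounded the integrand decays only like 1/‖z‖. The factor iA/(z + iA) supplies the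
  -- missing power, has modulus at most 1 and tends to 1 as A → ∞.
  have key : ∀ A : ℝ, 0 < A →
      ∫ t : ℝ, 1 / ((t : ℂ) - (starRingEnd ℂ) w) * h t *
        (A * Complex.I / (t + A * Complex.I)) = 0 := fun A hA => by
    refine (integral_real_line_eq_zero
      (G := fun z => 1 / (z - (starRingEnd ℂ) w) * h z * (A * Complex.I / (z + A * Complex.I)))
      (K := 2 * M * A) (ρ := 2 * ‖w‖ + 1) ?_ ?_).2
    · refine DifferentiableOn.mul (DifferentiableOn.mul ?_ (hd.mono hsub)) ?_
      · exact (differentiableOn_const _).div (by fun_prop) hne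
      · refine (differentiableOn_const _).div (by fun_prop) fun z hz h0 => ?_
        have := hnA A hA z hz
        rw [h0, norm_zero] at this
        linarith
    · intro z hz hzr
      have hw0 := norm_nonneg w
      have hz0 : 0 < ‖z‖ := by linarith
      have h2 : ‖z‖ / 2 ≤ ‖z - (starRingEnd ℂ) w‖ := by
        have := norm_sub_norm_le z ((starRingEnd ℂ) w)
        rw [RCLike.norm_conj] at this
        linarith
      have h3 : ‖z‖ ≤ ‖z + A * Complex.I‖ := by
        rw [← sq_le_sq₀ (norm_nonneg _) (norm_nonneg _), ← Complex.normSq_eq_norm_sq,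
          ← Complex.normSq_eq_norm_sq, Complex.normSq_apply, Complex.normSq_apply]
        simp
        nlinarith [mul_nonneg hA.le hz]
      have hMz := hM z hz
      rw [norm_mul, norm_mul, norm_div, norm_div, norm_one, norm_mul, Complex.norm_I, mul_one,
        Complex.norm_real, Real.norm_of_nonneg hA.le]
      calc 1 / ‖z - (starRingEnd ℂ) w‖ * ‖h z‖ * (A / ‖z + A * Complex.I‖)
          ≤ 1 / (‖z‖ / 2) * M * (A / ‖z‖) := by gcongr
        _ = 2 * M * A / ‖z‖ ^ 2 := by field_simp
  have hlim : Tendsto (fun A : ℝ => ∫ t : ℝ, 1 / ((t : ℂ) - (starRingEnd ℂ) w) * h t *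
        (A * Complex.I / (t + A * Complex.I))) atTop
      (𝓝 (∫ t : ℝ, 1 / ((t : ℂ) - (starRingEnd ℂ) w) * h t)) := by
    refine tendsto_integral_filter_of_dominated_convergence
      (fun t => ‖1 / ((t : ℂ) - (starRingEnd ℂ) w) * h t‖) ?_ ?_ hI.norm ?_
    · filter_upwards [eventually_gt_atTop 0] with A hA
      refine hI.aestronglyMeasurable.mul (Continuous.aestronglyMeasurable ?_)
      refine continuous_const.div (by fun_prop) fun t h0 => ?_
      have := hnA A hA t (by simp)
      rw [h0, norm_zero] at this
      linarith
    · filter_upwards [eventually_gt_atTop 0] with A hA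
      refine Eventually.of_forall fun t => ?_
      rw [norm_mul]
      refine mul_le_of_le_one_right (norm_nonneg _) ?_
      rw [norm_div, norm_mul, Complex.norm_I, mul_one, Complex.norm_real,
        Real.norm_of_nonneg hA.le]
      exact div_le_one_of_le₀ (hnA A hA t (by simp)) (norm_nonneg _)
    · refine Eventually.of_forall fun t => ?_
      have h0 : Tendsto (fun A : ℝ => Complex.I / ((t : ℂ) * ((A⁻¹ : ℝ) : ℂ) + Complex.I)) atTop
          (𝓝 (Complex.I / ((t : ℂ) * ((0 : ℝ) : ℂ) + Complex.I))) := by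
        refine tendsto_const_nhds.div ((tendsto_const_nhds.mul
          ((Complex.continuous_ofReal.tendsto 0).comp tendsto_inv_atTop_zero)).add
          tendsto_const_nhds) (by simp)
      have h1 : Tendsto (fun A : ℝ => A * Complex.I / (t + A * Complex.I)) atTop (𝓝 1) := by
        have e : Complex.I / ((t : ℂ) * ((0 : ℝ) : ℂ) + Complex.I) = 1 := by simp
        rw [e] at h0
        refine h0.congr' ?_
        filter_upwards [eventually_gt_atTop 0] with A hA
        have hA' : (A : ℂ) ≠ 0 := by exact_mod_cast hA.ne'
        have e2 : (t : ℂ) * ((A⁻¹ : ℝ) : ℂ) + Complex.I = (t + A * Complex.I) / A := by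
          push_cast; field_simp
        rw [e2, div_div_eq_mul_div, mul_comm]
      simpa using h1.const_mul (1 / ((t : ℂ) - (starRingEnd ℂ) w) * h t)
  refine tendsto_nhds_unique hlim (tendsto_const_nhds.congr' ?_)
  filter_upwards [eventually_gt_atTop 0] with A hA
  rw [key A hA]

/-! ### Sub-mean value estimates and boundedness of Hardy functions -/

/-- The sub-mean value property of `|g|²` on circles. -/
theorem two_pi_mul_enorm_sq_le {g : ℂ → ℂ} {z : ℂ} {r R : ℝ} (hr : 0 < r) (hrR : r < R)
    (hd : DifferentiableOn ℂ g (Metric.ball z R)) :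
    ENNReal.ofReal (2 * Real.pi) * ‖g z‖ₑ ^ 2 ≤
      ∫⁻ θ in Set.Ioo (-Real.pi) Real.pi, ‖g (circleMap z r θ)‖ₑ ^ 2 := by
  -- The mean value property is applied to the analytic function g², so taking norms gives the
  -- estimate for |g|² without a Cauchy–Schwarz step.
  have hdc : DiffContOnCl ℂ (fun ζ => g ζ ^ 2) (Metric.ball z |r|) := by
    rw [abs_of_pos hr]
    refine DifferentiableOn.diffContOnCl ?_
    rw [closure_ball _ hr.ne']
    exact (hd.mono (Metric.closedBall_subset_ball hrR)).pow 2
  have h1 := hdc.circleAverage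
  rw [Real.circleAverage_eq_integral_add (-Real.pi),
    intervalIntegral.integral_comp_add_right (fun θ => g (circleMap z r θ) ^ 2)] at h1
  have h2 : (2 * Real.pi) • g z ^ 2 = ∫ θ in Set.Ioo (-Real.pi) Real.pi,
      g (circleMap z r θ) ^ 2 := by
    rw [← h1, smul_smul, mul_inv_cancel₀ (by positivity), one_smul,
      intervalIntegral.integral_of_le (by linarith [Real.pi_pos]), integral_Ioc_eq_integral_Ioo]
    congr 3 <;> ring
  calc ENNReal.ofReal (2 * Real.pi) * ‖g z‖ₑ ^ 2 = ‖(2 * Real.pi) • g z ^ 2‖ₑ := by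
        rw [enorm_smul, enorm_pow, Real.enorm_eq_ofReal (by positivity)]
    _ ≤ ∫⁻ θ in Set.Ioo (-Real.pi) Real.pi, ‖g (circleMap z r θ) ^ 2‖ₑ := by
        rw [h2]; exact enorm_integral_le_lintegral_enorm _
    _ = _ := by simp_rw [enorm_pow]

/-- Functions here are controlled only on an open set; cutting off by the indicator gives a globally
measurable function to which Tonelli and changes of variables apply. -/
theorem measurable_indicator_enorm_sq {X : Type*} [TopologicalSpace X] [MeasurableSpace X]
    [OpensMeasurableSpace X] {g : X → ℂ} {s : Set X} (hs : IsOpen s) (hg : ContinuousOn g s) :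
    Measurable (s.indicator fun x => ‖g x‖ₑ ^ 2) := by
  classical
  rw [← Set.piecewise_eq_indicator]
  refine ContinuousOn.measurable_piecewise ?_ continuousOn_const hs.measurableSet
  exact (ENNReal.continuous_pow 2).comp_continuousOn hg.enorm

/-- The sub-mean value property of `|g|²` on discs. -/
theorem pi_sq_mul_enorm_sq_le {g : ℂ → ℂ} {z : ℂ} {R : ℝ} (hR : 0 < R)
    (hd : DifferentiableOn ℂ g (Metric.ball z R)) :
    ENNReal.ofReal (Real.pi * R ^ 2) * ‖g z‖ₑ ^ 2 ≤ ∫⁻ ζ in Metric.ball z R, ‖g ζ‖ₑ ^ 2 := by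
  set u : ℂ → ENNReal := (Metric.ball z R).indicator fun ζ => ‖g ζ‖ₑ ^ 2 with hu
  have hum : Measurable u := measurable_indicator_enorm_sq Metric.isOpen_ball hd.continuousOn
  rw [← lintegral_indicator Metric.isOpen_ball.measurableSet, ← hu,
    ← lintegral_add_left_eq_self u z, ← Complex.lintegral_comp_polarCoord_symm, polarCoord_target,
    Measure.volume_eq_prod, ← Measure.prod_restrict, lintegral_prod]
  · have hin : ∀ r ∈ Set.Ioo 0 R, ENNReal.ofReal r * (ENNReal.ofReal (2 * Real.pi) * ‖g z‖ₑ ^ 2) ≤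
        ∫⁻ θ in Set.Ioo (-Real.pi) Real.pi, ENNReal.ofReal (r, θ).1 •
          u (z + Complex.polarCoord.symm (r, θ)) := fun r hr => by
      have e : ∀ θ : ℝ, u (z + Complex.polarCoord.symm (r, θ)) = ‖g (circleMap z r θ)‖ₑ ^ 2 :=
        fun θ => by
          have : z + Complex.polarCoord.symm (r, θ) = circleMap z r θ := by
            rw [Complex.polarCoord_symm_apply, circleMap, Complex.exp_mul_I]
            simp
          rw [this, hu, Set.indicator_of_mem]
          rw [Metric.mem_ball, dist_eq_norm, circleMap_sub_center, norm_circleMap_zero,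
            abs_of_pos hr.1]
          exact hr.2
      simp_rw [e, smul_eq_mul]
      rw [lintegral_const_mul' _ _ ENNReal.ofReal_ne_top]
      gcongr
      exact two_pi_mul_enorm_sq_le hr.1 hr.2 hd
    calc ENNReal.ofReal (Real.pi * R ^ 2) * ‖g z‖ₑ ^ 2
        = ∫⁻ r in Set.Ioo 0 R, ENNReal.ofReal r * (ENNReal.ofReal (2 * Real.pi) * ‖g z‖ₑ ^ 2) := by
          rw [lintegral_mul_const _ (by fun_prop), ← ofReal_integral_eq_lintegral_ofReal,
            ← integral_Ioc_eq_integral_Ioo, ← intervalIntegral.integral_of_le hR.le, integral_id,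
            ← mul_assoc, ← ENNReal.ofReal_mul (by simp; positivity)]
          · congr 2; ring
          · exact (continuous_id.integrableOn_Icc (a := 0) (b := R)).mono_set
              Set.Ioo_subset_Icc_self
          · exact (ae_restrict_mem measurableSet_Ioo).mono fun r hr => hr.1.le
      _ ≤ ∫⁻ r in Set.Ioo 0 R, ∫⁻ θ in Set.Ioo (-Real.pi) Real.pi, ENNReal.ofReal (r, θ).1 •
          u (z + Complex.polarCoord.symm (r, θ)) := setLIntegral_mono' measurableSet_Ioo hin
      _ ≤ _ := lintegral_mono_set Set.Ioo_subset_Ioi_self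
  · refine Measurable.aemeasurable ?_
    simp_rw [smul_eq_mul, Complex.polarCoord_symm_apply]
    fun_prop

/-- Enlarging a disc to a horizontal strip brings in integrals over full lines, which are what the
Hardy norm controls. -/
theorem setLIntegral_ball_le_strip {v : ℂ → ENNReal} (hv : Measurable v) (z : ℂ) (R : ℝ) :
    ∫⁻ ζ in Metric.ball z R, v ζ ≤
      ∫⁻ η in Set.Ioo (z.im - R) (z.im + R), ∫⁻ ξ : ℝ, v (ξ + η * Complex.I) := by
  have hS : MeasurableSet {ζ : ℂ | ζ.im ∈ Set.Ioo (z.im - R) (z.im + R)} :=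
    Complex.measurable_im measurableSet_Ioo
  calc ∫⁻ ζ in Metric.ball z R, v ζ ≤ ∫⁻ ζ in {ζ : ℂ | ζ.im ∈ Set.Ioo (z.im - R) (z.im + R)}, v ζ := by
        refine lintegral_mono_set fun ζ hζ => ?_
        have h1 := Complex.abs_im_le_norm (ζ - z)
        have h2 : ‖ζ - z‖ < R := by simpa [dist_eq_norm] using hζ
        have h3 := abs_lt.1 (h1.trans_lt h2)
        simp at h3
        constructor <;> linarith [h3.1, h3.2]
    _ = ∫⁻ p in {p : ℝ × ℝ | p.2 ∈ Set.Ioo (z.im - R) (z.im + R)}, v (p.1 + p.2 * Complex.I) := by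
        have := Complex.volume_preserving_equiv_real_prod.symm.setLIntegral_comp_preimage hS hv
        rw [← this]
        simp_rw [Complex.measurableEquivRealProd_symm_apply, Complex.mk_eq_add_mul_I]
        congr 2
    _ = _ := by
        have : {p : ℝ × ℝ | p.2 ∈ Set.Ioo (z.im - R) (z.im + R)} =
            Set.univ ×ˢ Set.Ioo (z.im - R) (z.im + R) := by ext p; simp
        rw [this, Measure.volume_eq_prod, ← Measure.prod_restrict, lintegral_prod_symm',
          Measure.restrict_univ]
        fun_prop

theorem isOpen_biHalfPlane : IsOpen biHalfPlane :=
  (isOpen_lt continuous_const (Complex.continuous_im.comp continuous_fst)).inter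
    (isOpen_lt continuous_const (Complex.continuous_im.comp continuous_snd))

theorem tubePoint_mem {x y : ℝ × ℝ} (h1 : 0 < y.1) (h2 : 0 < y.2) :
    tubePoint x y ∈ biHalfPlane := by
  simp [tubePoint, biHalfPlane, h1, h2]

/-- Functions in the Hardy space are bounded away from the boundary. -/
theorem hardySpace_bounded {f : ℂ × ℂ → ℂ} (hf : f ∈ hardySpace) {δ : ℝ} (hδ : 0 < δ) :
    ∃ M, ∀ z : ℂ × ℂ, δ ≤ z.1.im → δ ≤ z.2.im → ‖f z‖ ≤ M := by
  obtain ⟨hA, C, hC⟩ := hf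
  set U : ℂ × ℂ → ENNReal := biHalfPlane.indicator fun z => ‖f z‖ₑ ^ 2 with hU
  have hUm : Measurable U := measurable_indicator_enorm_sq isOpen_biHalfPlane hA.continuousOn
  have hUe : ∀ z ∈ biHalfPlane, U z = ‖f z‖ₑ ^ 2 := fun z hz => Set.indicator_of_mem hz _
  -- Discs of radius δ/2 about points of height at least δ stay in the half-plane, and the enclosing
  -- strips have width δ, hence the factor δ² in B.
  set R := δ / 2 with hR
  have hR0 : 0 < R := by positivity
  set c := ENNReal.ofReal (Real.pi * R ^ 2) with hc
  have hc0 : c ≠ 0 := by simp [hc]; positivity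
  have hct : c ≠ ⊤ := ENNReal.ofReal_ne_top
  set B : ENNReal := C * (ENNReal.ofReal δ * ENNReal.ofReal δ) with hB
  have hBt : B ≠ ⊤ := ENNReal.mul_ne_top ENNReal.coe_ne_top
    (ENNReal.mul_ne_top ENNReal.ofReal_ne_top ENNReal.ofReal_ne_top)
  have him : ∀ z ζ : ℂ, δ ≤ z.im → ζ ∈ Metric.ball z R → 0 < ζ.im := fun z ζ hz hζ => by
    have h1 := Complex.abs_im_le_norm (ζ - z)
    have h2 : ‖ζ - z‖ < R := by simpa [dist_eq_norm] using hζ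
    have h3 := abs_lt.1 (h1.trans_lt h2)
    simp at h3
    linarith [h3.1]
  have key : ∀ z : ℂ × ℂ, δ ≤ z.1.im → δ ≤ z.2.im → c * (c * ‖f z‖ₑ ^ 2) ≤ B := by
    intro z hz1 hz2
    have hstrip : ∀ a : ℝ, volume (Set.Ioo (a - R) (a + R)) = ENNReal.ofReal δ := fun a => by
      rw [Real.volume_Ioo]; congr 1; rw [hR]; ring
    calc c * (c * ‖f z‖ₑ ^ 2)
        ≤ c * ∫⁻ ζ₁ in Metric.ball z.1 R, ‖f (ζ₁, z.2)‖ₑ ^ 2 := by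
          gcongr
          refine pi_sq_mul_enorm_sq_le (g := fun ζ => f (ζ, z.2)) hR0 fun ζ hζ => ?_
          have : (ζ, z.2) ∈ biHalfPlane := ⟨him _ _ hz1 hζ, hδ.trans_le hz2⟩
          exact ((hA _ this).differentiableAt.comp (f := fun ζ : ℂ => (ζ, z.2)) ζ
            (by fun_prop)).differentiableWithinAt
      _ = ∫⁻ ζ₁ in Metric.ball z.1 R, c * ‖f (ζ₁, z.2)‖ₑ ^ 2 :=
          (lintegral_const_mul' _ _ hct).symm
      _ ≤ ∫⁻ ζ₁ in Metric.ball z.1 R, ∫⁻ ζ₂ in Metric.ball z.2 R, U (ζ₁, ζ₂) := by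
          refine setLIntegral_mono' Metric.isOpen_ball.measurableSet fun ζ₁ hζ₁ => ?_
          refine (pi_sq_mul_enorm_sq_le (g := fun ζ => f (ζ₁, ζ)) hR0 fun ζ hζ => ?_).trans
            (setLIntegral_mono' Metric.isOpen_ball.measurableSet fun ζ hζ => ?_)
          · have : (ζ₁, ζ) ∈ biHalfPlane := ⟨him _ _ hz1 hζ₁, him _ _ hz2 hζ⟩
            exact ((hA _ this).differentiableAt.comp (f := fun ζ : ℂ => (ζ₁, ζ)) ζ
              (by fun_prop)).differentiableWithinAt
          · exact (hUe _ ⟨him _ _ hz1 hζ₁, him _ _ hz2 hζ⟩).ge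
      _ ≤ ∫⁻ ζ₁ in Metric.ball z.1 R, ∫⁻ η₂ in Set.Ioo (z.2.im - R) (z.2.im + R),
            ∫⁻ ξ₂ : ℝ, U (ζ₁, ξ₂ + η₂ * Complex.I) :=
          lintegral_mono fun ζ₁ => setLIntegral_ball_le_strip (v := fun ζ => U (ζ₁, ζ))
            (by fun_prop) _ _
      _ ≤ ∫⁻ η₁ in Set.Ioo (z.1.im - R) (z.1.im + R), ∫⁻ ξ₁ : ℝ,
            ∫⁻ η₂ in Set.Ioo (z.2.im - R) (z.2.im + R),
              ∫⁻ ξ₂ : ℝ, U (ξ₁ + η₁ * Complex.I, ξ₂ + η₂ * Complex.I) := by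
          refine setLIntegral_ball_le_strip (v := fun ζ₁ => ∫⁻ η₂ in Set.Ioo (z.2.im - R) (z.2.im + R),
            ∫⁻ ξ₂ : ℝ, U (ζ₁, ξ₂ + η₂ * Complex.I)) ?_ _ _
          refine Measurable.lintegral_prod_right' (f := fun p : ℂ × ℝ =>
            ∫⁻ ξ₂ : ℝ, U (p.1, ξ₂ + p.2 * Complex.I)) ?_
          exact Measurable.lintegral_prod_right' (f := fun p : (ℂ × ℝ) × ℝ =>
            U (p.1.1, p.2 + p.1.2 * Complex.I)) (by fun_prop)
      -- The swap makes the two line integrals innermost, so that at fixed heights (η₁, η₂) the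
      -- Hardy bound applies.
      _ = ∫⁻ η₁ in Set.Ioo (z.1.im - R) (z.1.im + R),
            ∫⁻ η₂ in Set.Ioo (z.2.im - R) (z.2.im + R), ∫⁻ ξ₁ : ℝ,
              ∫⁻ ξ₂ : ℝ, U (ξ₁ + η₁ * Complex.I, ξ₂ + η₂ * Complex.I) := by
          refine lintegral_congr fun η₁ => lintegral_lintegral_swap (Measurable.aemeasurable ?_)
          exact Measurable.lintegral_prod_right' (f := fun p : (ℝ × ℝ) × ℝ =>
            U (p.1.1 + η₁ * Complex.I, p.2 + p.1.2 * Complex.I)) (by fun_prop)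
      _ ≤ ∫⁻ η₁ in Set.Ioo (z.1.im - R) (z.1.im + R),
            ∫⁻ η₂ in Set.Ioo (z.2.im - R) (z.2.im + R), (C : ENNReal) := by
          refine setLIntegral_mono' measurableSet_Ioo fun η₁ h₁ =>
            setLIntegral_mono' measurableSet_Ioo fun η₂ h₂ => ?_
          have h1 : 0 < η₁ := by linarith [h₁.1]
          have h2 : 0 < η₂ := by linarith [h₂.1]
          rw [← lintegral_prod (fun p : ℝ × ℝ => U (p.1 + η₁ * Complex.I, p.2 + η₂ * Complex.I))
            (by fun_prop), ← Measure.volume_eq_prod]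
          refine le_trans (le_of_eq (lintegral_congr fun p => ?_)) (hC (η₁, η₂) h1 h2)
          exact hUe _ (tubePoint_mem (x := p) (y := (η₁, η₂)) h1 h2)
      _ = B := by
          simp only [lintegral_const, Measure.restrict_apply MeasurableSet.univ, Set.univ_inter,
            hstrip, hB, mul_assoc]
  refine ⟨√((B / (c * c)).toReal), fun z hz1 hz2 => Real.le_sqrt_of_sq_le ?_⟩
  have h1 : ‖f z‖ₑ ^ 2 ≤ B / (c * c) := by
    rw [ENNReal.le_div_iff_mul_le (.inl (mul_ne_zero hc0 hc0)) (.inl (ENNReal.mul_ne_top hct hct))]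
    calc _ = c * (c * ‖f z‖ₑ ^ 2) := by ring
      _ ≤ B := key z hz1 hz2
  have h2 := ENNReal.toReal_mono (ENNReal.div_ne_top hBt (mul_ne_zero hc0 hc0)) h1
  simpa using h2

/-! ### The two-variable Cauchy formula for functions analytic past the boundary -/

theorem continuous_inv_ofReal_sub {w : ℂ} (hw : w.im ≠ 0) :
    Continuous fun t : ℝ => 1 / ((t : ℂ) - w) :=
  continuous_const.div (by fun_prop) (ofReal_sub_ne_zero hw)

theorem memLp_two_cauchyKernel {a b : ℂ} (ha : a.im ≠ 0) (hb : b.im ≠ 0) :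
    MemLp (fun t : ℝ × ℝ => 1 / ((t.1 : ℂ) - a) * (1 / ((t.2 : ℂ) - b))) 2 := by
  have hcont : Continuous fun t : ℝ × ℝ => 1 / ((t.1 : ℂ) - a) * (1 / ((t.2 : ℂ) - b)) :=
    ((continuous_inv_ofReal_sub ha).comp continuous_fst).mul
      ((continuous_inv_ofReal_sub hb).comp continuous_snd)
  rw [memLp_two_iff_integrable_sq_norm hcont.aestronglyMeasurable, Measure.volume_eq_prod]
  simp_rw [norm_mul, mul_pow]
  exact ((memLp_two_inv_ofReal_sub ha).integrable_norm_pow two_ne_zero).mul_prod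
    ((memLp_two_inv_ofReal_sub hb).integrable_norm_pow two_ne_zero)

theorem ae_memLp_two_of_memLp_two_prod {g : ℝ × ℝ → ℂ} (hc : Continuous g) (hg : MemLp g 2) :
    (∀ᵐ x : ℝ, MemLp (fun y => g (x, y)) 2) ∧ ∀ᵐ y : ℝ, MemLp (fun x => g (x, y)) 2 := by
  have h1 := (memLp_two_iff_integrable_sq_norm hc.aestronglyMeasurable).1 hg
  rw [Measure.volume_eq_prod] at h1
  refine ⟨h1.prod_right_ae.mono fun x hx => ?_, h1.prod_left_ae.mono fun y hy => ?_⟩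
  · have : Continuous fun y => g (x, y) := by fun_prop
    exact (memLp_two_iff_integrable_sq_norm this.aestronglyMeasurable).2 hx
  · have : Continuous fun x => g (x, y) := by fun_prop
    exact (memLp_two_iff_integrable_sq_norm this.aestronglyMeasurable).2 hy

/-- The product Poisson kernel reproduces f by two one-variable Poisson formulas. Expanding it gives
four products of kernels, and the three containing a conjugate kernel vanish upon integrating first
in that variable. -/
theorem integral_cauchyKernel_mul_eq {f : ℂ × ℂ → ℂ} {δ M : ℝ} (hδ : δ < 0)
    (hd : DifferentiableOn ℂ f {z | δ < z.1.im ∧ δ < z.2.im})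
    (hM : ∀ z : ℂ × ℂ, 0 ≤ z.1.im → 0 ≤ z.2.im → ‖f z‖ ≤ M)
    (hL : MemLp (fun t : ℝ × ℝ => f (t.1, t.2)) 2) {w : ℂ × ℂ} (hw : w ∈ biHalfPlane) :
    1 / (2 * (Real.pi : ℂ) * Complex.I) ^ 2 *
      ∫ t : ℝ × ℝ, 1 / ((t.1 : ℂ) - w.1) * (1 / ((t.2 : ℂ) - w.2)) * f (t.1, t.2) = f w := by
  obtain ⟨hw1, hw2⟩ := hw
  have hcw1 : ((starRingEnd ℂ) w.1).im ≠ 0 := by simpa using hw1.ne'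
  have hcw2 : ((starRingEnd ℂ) w.2).im ≠ 0 := by simpa using hw2.ne'
  have hc : Continuous fun t : ℝ × ℝ => f (t.1, t.2) :=
    hd.continuousOn.comp_continuous (by fun_prop) fun t => by simpa using hδ
  have hslice1 : ∀ z₂ : ℂ, 0 ≤ z₂.im →
      DifferentiableOn ℂ (fun z => f (z, z₂)) {z | δ < z.im} := fun z₂ hz₂ =>
    hd.comp (f := fun z : ℂ => (z, z₂)) (by fun_prop) fun z hz => ⟨hz, hδ.trans_le hz₂⟩
  have hslice2 : ∀ z₁ : ℂ, 0 ≤ z₁.im →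
      DifferentiableOn ℂ (fun z => f (z₁, z)) {z | δ < z.im} := fun z₁ hz₁ =>
    hd.comp (f := fun z : ℂ => (z₁, z)) (by fun_prop) fun z hz => ⟨hδ.trans_le hz₁, hz⟩
  obtain ⟨hL2, hL1⟩ := ae_memLp_two_of_memLp_two_prod hc hL
  set k : ℂ → ℝ → ℂ := fun a t => 1 / ((t : ℂ) - a) with hk
  have hI : ∀ a b : ℂ, a.im ≠ 0 → b.im ≠ 0 →
      Integrable fun t : ℝ × ℝ => k a t.1 * k b t.2 * f (t.1, t.2) := fun a b ha hb =>
    (memLp_two_cauchyKernel ha hb).integrable_mul hL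
  -- The inner integral is over t₁; it vanishes for almost every t₂, namely where the slice is
  -- square integrable.
  have hz1 : ∀ b : ℂ, b.im ≠ 0 →
      ∫ t : ℝ × ℝ, k ((starRingEnd ℂ) w.1) t.1 * k b t.2 * f (t.1, t.2) = 0 := fun b hb => by
    have h := hI _ b hcw1 hb
    rw [Measure.volume_eq_prod] at h ⊢
    rw [integral_prod_symm _ h]
    refine integral_eq_zero_of_ae (hL1.mono fun t₂ ht₂ => ?_)
    have := integral_div_sub_conj_eq_zero hδ (hslice1 t₂ (by simp)) (M := M)
      (fun z hz => hM _ hz (by simp)) ht₂ hw1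
    calc _ = ∫ t₁ : ℝ, k b t₂ * (k ((starRingEnd ℂ) w.1) t₁ * f (t₁, t₂)) := by
          refine integral_congr_ae (.of_forall fun t => ?_)
          dsimp only
          ring
      _ = 0 := by rw [integral_const_mul, this, mul_zero]
  have hz2 : ∀ a : ℂ, a.im ≠ 0 →
      ∫ t : ℝ × ℝ, k a t.1 * k ((starRingEnd ℂ) w.2) t.2 * f (t.1, t.2) = 0 := fun a ha => by
    have h := hI a _ ha hcw2
    rw [Measure.volume_eq_prod] at h ⊢
    rw [integral_prod _ h]
    refine integral_eq_zero_of_ae (hL2.mono fun t₁ ht₁ => ?_)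
    have := integral_div_sub_conj_eq_zero hδ (hslice2 t₁ (by simp)) (M := M)
      (fun z hz => hM _ (by simp) hz) ht₁ hw2
    calc _ = ∫ t₂ : ℝ, k a t₁ * (k ((starRingEnd ℂ) w.2) t₂ * f (t₁, t₂)) := by
          refine integral_congr_ae (.of_forall fun t => ?_)
          dsimp only
          ring
      _ = 0 := by rw [integral_const_mul, this, mul_zero]
  set c : ℂ := 1 / (2 * Real.pi * Complex.I) with hcdef
  have hP : ∀ t : ℝ × ℝ, (halfPlanePoisson w.1 t.1 : ℂ) * ((halfPlanePoisson w.2 t.2 : ℂ) *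
      f (t.1, t.2)) = c ^ 2 * (k w.1 t.1 * k w.2 t.2 * f (t.1, t.2)
        - k w.1 t.1 * k ((starRingEnd ℂ) w.2) t.2 * f (t.1, t.2)
        - k ((starRingEnd ℂ) w.1) t.1 * k w.2 t.2 * f (t.1, t.2)
        + k ((starRingEnd ℂ) w.1) t.1 * k ((starRingEnd ℂ) w.2) t.2 * f (t.1, t.2)) := fun t => by
    rw [ofReal_halfPlanePoisson hw1, ofReal_halfPlanePoisson hw2]
    ring
  have hI11 := hI w.1 w.2 hw1.ne' hw2.ne'
  have hI12 := hI w.1 _ hw1.ne' hcw2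
  have hI21 := hI _ w.2 hcw1 hw2.ne'
  have hI22 := hI _ _ hcw1 hcw2
  have hPI : Integrable fun t : ℝ × ℝ => (halfPlanePoisson w.1 t.1 : ℂ) *
      ((halfPlanePoisson w.2 t.2 : ℂ) * f (t.1, t.2)) := by
    simp_rw [hP]
    exact (((hI11.sub hI12).sub hI21).add hI22).const_mul _
  have e1 : ∫ t : ℝ × ℝ, (halfPlanePoisson w.1 t.1 : ℂ) * ((halfPlanePoisson w.2 t.2 : ℂ) *
      f (t.1, t.2)) = c ^ 2 * ∫ t : ℝ × ℝ, k w.1 t.1 * k w.2 t.2 * f (t.1, t.2) := by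
    simp_rw [hP]
    have hA : Integrable fun t : ℝ × ℝ => k w.1 t.1 * k w.2 t.2 * f (t.1, t.2)
        - k w.1 t.1 * k ((starRingEnd ℂ) w.2) t.2 * f (t.1, t.2) := hI11.sub hI12
    have hB : Integrable fun t : ℝ × ℝ => k w.1 t.1 * k w.2 t.2 * f (t.1, t.2)
        - k w.1 t.1 * k ((starRingEnd ℂ) w.2) t.2 * f (t.1, t.2)
        - k ((starRingEnd ℂ) w.1) t.1 * k w.2 t.2 * f (t.1, t.2) := hA.sub hI21
    rw [integral_const_mul, integral_add hB hI22, integral_sub hA hI21, integral_sub hI11 hI12, hz1 _ hcw2, hz1 _ hw2.ne',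
      hz2 _ hw1.ne']
    ring
  have e2 : ∫ t : ℝ × ℝ, (halfPlanePoisson w.1 t.1 : ℂ) * ((halfPlanePoisson w.2 t.2 : ℂ) *
      f (t.1, t.2)) = f w := by
    rw [Measure.volume_eq_prod] at hPI ⊢
    rw [integral_prod _ hPI]
    simp_rw [integral_const_mul]
    have h2 : ∀ t₁ : ℝ, ∫ t₂ : ℝ, (halfPlanePoisson w.2 t₂ : ℂ) * f (t₁, t₂) = f (t₁, w.2) :=
      fun t₁ => integral_halfPlanePoisson_mul hδ (hslice2 t₁ (by simp)) (M := M)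
        (fun z hz => hM _ (by simp) hz) hw2
    simp_rw [h2]
    exact integral_halfPlanePoisson_mul hδ (hslice1 w.2 hw2.le) (M := M)
        (fun z hz => hM _ hz hw2.le) hw1
  rw [← e2, e1, hcdef, div_pow, one_pow]

/-! ### Poisson representation in the one-variable Hardy space -/

theorem memLp_two_halfPlanePoisson {w : ℂ} (hw : 0 < w.im) :
    MemLp (fun t : ℝ => (halfPlanePoisson w t : ℂ)) 2 := by
  simp_rw [ofReal_halfPlanePoisson hw]
  exact ((memLp_two_inv_ofReal_sub hw.ne').sub
    (memLp_two_inv_ofReal_sub (by simpa using hw.ne'))).const_mul _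

theorem lintegral_halfPlanePoisson {w : ℂ} (hw : 0 < w.im) :
    ∫⁻ t, ENNReal.ofReal (halfPlanePoisson w t) = 1 := by
  rw [← ofReal_integral_eq_lintegral_ofReal (integrable_halfPlanePoisson hw)
    (.of_forall (halfPlanePoisson_nonneg hw)), integral_halfPlanePoisson hw, ENNReal.ofReal_one]

theorem enorm_halfPlanePoisson {w : ℂ} (hw : 0 < w.im) (t : ℝ) :
    ‖(halfPlanePoisson w t : ℂ)‖ₑ = ENNReal.ofReal (halfPlanePoisson w t) := by
  rw [← ofReal_norm, Complex.norm_real, Real.norm_of_nonneg (halfPlanePoisson_nonneg hw t)]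

/-- The Poisson formula on a horizontal line inside the upper half-plane. -/
theorem integral_halfPlanePoisson_mul_shift {h : ℂ → ℂ}
    (hd : DifferentiableOn ℂ h {z | 0 < z.im})
    (hb : ∀ δ > 0, ∃ M, ∀ z : ℂ, δ ≤ z.im → ‖h z‖ ≤ M) {a : ℝ} (ha : 0 < a) {w : ℂ}
    (hw : 0 < w.im) :
    ∫ t : ℝ, (halfPlanePoisson w t : ℂ) * h (t + a * Complex.I) = h (w + a * Complex.I) := by
  obtain ⟨M, hM⟩ := hb a ha
  exact integral_halfPlanePoisson_mul (h := fun z => h (z + a * Complex.I)) (δ := -a) (M := M)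
    (by linarith) (hd.comp (f := fun z : ℂ => z + a * Complex.I) (by fun_prop) fun z hz => by
      simp at hz ⊢; linarith) (fun z hz => hM _ (by simpa using hz)) hw

theorem sq_lintegral_le_lintegral_sq {X : Type*} [MeasurableSpace X] (μ : Measure X)
    [IsProbabilityMeasure μ] {u : X → ENNReal} (hu : AEMeasurable u μ) :
    (∫⁻ x, u x ∂μ) ^ 2 ≤ ∫⁻ x, u x ^ 2 ∂μ := by
  have h := ENNReal.lintegral_mul_le_Lp_mul_Lq μ Real.HolderConjugate.two_two hu
    (aemeasurable_const (b := (1 : ENNReal)))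
  simp only [Pi.mul_apply, mul_one, ENNReal.one_rpow, lintegral_const, measure_univ] at h
  calc (∫⁻ x, u x ∂μ) ^ 2 ≤ ((∫⁻ x, u x ^ (2 : ℝ) ∂μ) ^ (1 / 2 : ℝ)) ^ 2 := by gcongr
    _ = ∫⁻ x, u x ^ 2 ∂μ := by
      rw [← ENNReal.rpow_natCast, ← ENNReal.rpow_mul]
      simp

/-- The Poisson kernel is a probability density, so this is Jensen's inequality for the square. -/
theorem sq_lintegral_poisson_le {w : ℂ} (hw : 0 < w.im) {u : ℝ → ENNReal} (hu : Measurable u) :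
    (∫⁻ t, ENNReal.ofReal (halfPlanePoisson w t) * u t) ^ 2 ≤
      ∫⁻ t, ENNReal.ofReal (halfPlanePoisson w t) * u t ^ 2 := by
  have hm : Measurable fun t => ENNReal.ofReal (halfPlanePoisson w t) :=
    (continuous_halfPlanePoisson hw).measurable.ennreal_ofReal
  have : IsProbabilityMeasure
      (volume.withDensity fun t => ENNReal.ofReal (halfPlanePoisson w t)) :=
    ⟨by rw [withDensity_apply _ .univ, setLIntegral_univ, lintegral_halfPlanePoisson hw]⟩
  have h := sq_lintegral_le_lintegral_sq
    (volume.withDensity fun t => ENNReal.ofReal (halfPlanePoisson w t)) hu.aemeasurable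
  rw [lintegral_withDensity_eq_lintegral_mul _ hm hu,
    lintegral_withDensity_eq_lintegral_mul _ hm (hu.pow_const 2)] at h
  exact h

/-- The `L²` means over horizontal lines decrease with the height. -/
theorem lintegral_enorm_sq_line_antitone {h : ℂ → ℂ}
    (hd : DifferentiableOn ℂ h {z | 0 < z.im})
    (hb : ∀ δ > 0, ∃ M, ∀ z : ℂ, δ ≤ z.im → ‖h z‖ ≤ M) {a b : ℝ} (ha : 0 < a) (hab : a ≤ b) :
    ∫⁻ x : ℝ, ‖h (x + b * Complex.I)‖ₑ ^ 2 ≤ ∫⁻ x : ℝ, ‖h (x + a * Complex.I)‖ₑ ^ 2 := by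
  rcases hab.eq_or_lt with rfl | hab
  · rfl
  set s := b - a with hs
  have hs0 : 0 < s := sub_pos.2 hab
  have him : ∀ x : ℝ, 0 < ((x : ℂ) + s * Complex.I).im := fun x => by simpa using hs0
  have hcont : Continuous fun t : ℝ => h (t + a * Complex.I) :=
    hd.continuousOn.comp_continuous (by fun_prop) fun t => by simpa using ha
  have hum : Measurable fun t : ℝ => ‖h (t + a * Complex.I)‖ₑ := hcont.measurable.enorm
  have hpt : ∀ x : ℝ, ‖h (x + b * Complex.I)‖ₑ ^ 2 ≤
      ∫⁻ t : ℝ, ENNReal.ofReal (halfPlanePoisson (t + s * Complex.I) x) *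
        ‖h (t + a * Complex.I)‖ₑ ^ 2 := fun x => by
    have e : (x : ℂ) + b * Complex.I = x + s * Complex.I + a * Complex.I := by
      rw [hs]; push_cast; ring
    rw [e, ← integral_halfPlanePoisson_mul_shift hd hb ha (him x)]
    calc _ ≤ (∫⁻ t : ℝ, ENNReal.ofReal (halfPlanePoisson (x + s * Complex.I) t) *
          ‖h (t + a * Complex.I)‖ₑ) ^ 2 := by
          gcongr
          refine (enorm_integral_le_lintegral_enorm _).trans (le_of_eq (lintegral_congr fun t => ?_))
          rw [enorm_mul, enorm_halfPlanePoisson (him x)]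
      _ ≤ _ := sq_lintegral_poisson_le (him x) hum
      -- At equal height the kernel is symmetric in its pole and its variable, so after Tonelli it
      -- can be integrated out in x to give 1.
      _ = _ := lintegral_congr fun t => by
          congr 2
          simp [halfPlanePoisson]
          left
          ring
  calc _ ≤ ∫⁻ x : ℝ, ∫⁻ t : ℝ, ENNReal.ofReal (halfPlanePoisson (t + s * Complex.I) x) *
        ‖h (t + a * Complex.I)‖ₑ ^ 2 := lintegral_mono hpt
    _ = ∫⁻ t : ℝ, ∫⁻ x : ℝ, ENNReal.ofReal (halfPlanePoisson (t + s * Complex.I) x) *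
        ‖h (t + a * Complex.I)‖ₑ ^ 2 := by
        refine lintegral_lintegral_swap (Measurable.aemeasurable ?_)
        refine Measurable.mul ?_ ((hum.comp measurable_snd).pow_const 2)
        unfold halfPlanePoisson
        fun_prop
    _ = _ := by
        refine lintegral_congr fun t => ?_
        rw [lintegral_mul_const _
          ((continuous_halfPlanePoisson (him t)).measurable.ennreal_ofReal),
          lintegral_halfPlanePoisson (him t), one_mul]

theorem memLp_two_of_lintegral_le {X : Type*} [MeasurableSpace X] {μ : Measure X} {g : X → ℂ}
    (hg : AEStronglyMeasurable g μ) {C : NNReal} (h : ∫⁻ x, ‖g x‖ₑ ^ 2 ∂μ ≤ C) :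
    MemLp g 2 μ ∧ eLpNorm g 2 μ ≤ ENNReal.ofReal √C := by
  have h1 : eLpNorm g 2 μ ≤ ENNReal.ofReal √C := by
    rw [eLpNorm_eq_lintegral_rpow_enorm_toReal two_ne_zero ENNReal.ofNat_ne_top]
    simp only [ENNReal.toReal_ofNat, ENNReal.rpow_ofNat]
    rw [Real.sqrt_eq_rpow, ← ENNReal.ofReal_rpow_of_nonneg (x := (C : ℝ)) (p := 1 / 2) C.2
      (by norm_num), ENNReal.ofReal_coe_nnreal]
    gcongr
  exact ⟨⟨hg, h1.trans_lt ENNReal.ofReal_lt_top⟩, h1⟩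

/-- A function in the Hardy space of the half-plane is the Poisson integral of an `L²` function. -/
theorem exists_memLp_two_poisson_eq {h : ℂ → ℂ}
    (hd : DifferentiableOn ℂ h {z | 0 < z.im})
    (hb : ∀ δ > 0, ∃ M, ∀ z : ℂ, δ ≤ z.im → ‖h z‖ ≤ M) {C : NNReal}
    (hC : ∀ y : ℝ, 0 < y → ∫⁻ x : ℝ, ‖h (x + y * Complex.I)‖ₑ ^ 2 ≤ C) :
    ∃ F : ℝ → ℂ, MemLp F 2 ∧
      ∀ w : ℂ, 0 < w.im → ∫ t : ℝ, (halfPlanePoisson w t : ℂ) * F t = h w := by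
  have hmem : ∀ y : ℝ, 0 < y → MemLp (fun x : ℝ => h (x + y * Complex.I)) 2 ∧
      eLpNorm (fun x : ℝ => h (x + y * Complex.I)) 2 ≤ ENNReal.ofReal √C := fun y hy =>
    memLp_two_of_lintegral_le (hd.continuousOn.comp_continuous (by fun_prop) fun t => by
      simpa using hy).aestronglyMeasurable (hC y hy)
  -- The value 0 for y ≤ 0 is a dummy that keeps the norm bound valid for all y; only y ↓ 0 matters.
  let u : ℝ → Lp ℂ 2 (volume : Measure ℝ) := fun y =>
    if hy : 0 < y then (hmem y hy).1.toLp else 0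
  have hu : ∀ y, ‖u y‖ ≤ √C := fun y => by
    by_cases hy : 0 < y
    · simp only [u, dif_pos hy, Lp.norm_toLp]
      exact ENNReal.toReal_le_of_le_ofReal (Real.sqrt_nonneg _) (hmem y hy).2
    · simp [u, dif_neg hy]
  let T : ℝ → WeakDual ℂ (Lp ℂ 2 (volume : Measure ℝ)) := fun y =>
    StrongDual.toWeakDual (InnerProductSpace.toDual ℂ _ (u y))
  -- An ultrafilter finer than y ↓ 0 converges in the weak-* compact ball, so no subsequence has to
  -- be extracted.
  let 𝓕 : Ultrafilter ℝ := Ultrafilter.of (𝓝[>] (0 : ℝ))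
  have h𝓕 : (𝓕 : Filter ℝ) ≤ 𝓝[>] 0 := Ultrafilter.of_le _
  obtain ⟨ℓ, -, hℓ⟩ := (WeakDual.isCompact_closedBall (𝕜 := ℂ)
    (0 : StrongDual ℂ (Lp ℂ 2 (volume : Measure ℝ))) (√C)).ultrafilter_le_nhds (𝓕.map T) (by
      rw [le_principal_iff]
      refine Filter.mem_map.2 (Filter.univ_mem' fun y => ?_)
      simp [T, hu y])
  have hlim : ∀ g : Lp ℂ 2 (volume : Measure ℝ), Tendsto (fun y => inner ℂ (u y) g) 𝓕 (𝓝 (ℓ g)) :=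
    fun g => ((WeakDual.eval_continuous g).tendsto ℓ).comp hℓ
  set F : Lp ℂ 2 (volume : Measure ℝ) :=
    (InnerProductSpace.toDual ℂ _).symm (WeakDual.toStrongDual ℓ) with hF
  refine ⟨F, Lp.memLp F, fun w hw => ?_⟩
  set g := (memLp_two_halfPlanePoisson hw).toLp with hg
  -- The inner product is conjugate-linear in its first argument and the kernel is real, hence the
  -- conjugate.
  have hinner : ∀ v : Lp ℂ 2 (volume : Measure ℝ), ∀ v' : ℝ → ℂ, v =ᵐ[volume] v' →
      inner ℂ v g = (starRingEnd ℂ) (∫ t : ℝ, (halfPlanePoisson w t : ℂ) * v' t) := by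
    intro v v' hv
    rw [L2.inner_def, ← integral_conj]
    refine integral_congr_ae ?_
    filter_upwards [hv, (memLp_two_halfPlanePoisson hw).coeFn_toLp] with t h1 h2
    rw [h1, h2]
    simp
  have h1 : ℓ g = (starRingEnd ℂ) (∫ t : ℝ, (halfPlanePoisson w t : ℂ) * F t) := by
    rw [← hinner F F (ae_eq_refl _), hF, InnerProductSpace.toDual_symm_apply]
    rfl
  have h2 : Tendsto (fun y : ℝ => (starRingEnd ℂ) (h (w + y * Complex.I))) (𝓝[>] 0)
      (𝓝 ((starRingEnd ℂ) (h w))) := by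
    have hcw : ContinuousAt h w := (hd.differentiableAt
      ((isOpen_lt continuous_const Complex.continuous_im).mem_nhds hw)).continuousAt
    have : Tendsto (fun y : ℝ => w + y * Complex.I) (𝓝 0) (𝓝 w) :=
      (by fun_prop : Continuous fun y : ℝ => w + y * Complex.I).tendsto' _ _ (by simp)
    exact (Complex.continuous_conj.tendsto _).comp
      (hcw.tendsto.comp (this.mono_left nhdsWithin_le_nhds))
  have h3 : Tendsto (fun y => inner ℂ (u y) g) 𝓕 (𝓝 ((starRingEnd ℂ) (h w))) := by
    refine (h2.mono_left h𝓕).congr' ?_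
    filter_upwards [h𝓕 self_mem_nhdsWithin] with y hy
    rw [hinner (u y) (fun x : ℝ => h (x + y * Complex.I))
      (by simp only [u, dif_pos (Set.mem_Ioi.1 hy)]; exact (hmem y hy).1.coeFn_toLp),
      integral_halfPlanePoisson_mul_shift hd hb hy hw]
  have h4 := tendsto_nhds_unique (hlim g) h3
  rw [h1] at h4
  exact (starRingEnd ℂ).injective h4

/-! ### Almost everywhere convergence of Poisson integrals -/

/-- Take the least k whose dyadic ball contains t: for k > 0 minimality forces |t - x| > 2^(k-1) y,
which makes the kernel small. -/
theorem halfPlanePoisson_le_dyadic (x t : ℝ) {y : ℝ} (hy : 0 < y) :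
    ∃ k : ℕ, t ∈ Metric.closedBall x (2 ^ k * y) ∧
      halfPlanePoisson (x + y * Complex.I) t ≤ 4 * (4 ^ k)⁻¹ / y := by
  have hex : ∃ k : ℕ, |t - x| ≤ 2 ^ k * y := by
    obtain ⟨k, hk⟩ := pow_unbounded_of_one_lt (|t - x| / y) one_lt_two
    exact ⟨k, by rw [div_lt_iff₀ hy] at hk; exact hk.le⟩
  classical
  refine ⟨Nat.find hex, by simpa [Real.dist_eq] using Nat.find_spec hex, ?_⟩
  have hP : halfPlanePoisson (x + y * Complex.I) t ≤ y * ((t - x) ^ 2 + y ^ 2)⁻¹ := by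
    have : y / Real.pi ≤ y := div_le_self hy.le (by linarith [Real.pi_gt_three])
    simp only [halfPlanePoisson, Complex.add_re, Complex.ofReal_re, Complex.mul_re, Complex.I_re,
      mul_zero, Complex.ofReal_im, Complex.I_im, mul_one, sub_self, add_zero, Complex.add_im,
      Complex.mul_im, zero_add]
    gcongr
  refine hP.trans ?_
  rcases Nat.eq_zero_or_pos (Nat.find hex) with h0 | h0
  · rw [h0, ← div_eq_mul_inv, div_le_div_iff₀ (by positivity) hy]
    nlinarith [sq_nonneg (t - x)]
  · obtain ⟨m, hm⟩ := Nat.exists_eq_succ_of_ne_zero h0.ne'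
    have h1 : 2 ^ m * y < |t - x| := not_le.1 (Nat.find_min hex (m := m) (by omega))
    have h2 : (2 ^ m * y) ^ 2 < (t - x) ^ 2 := by
      rw [← sq_abs (t - x)]
      gcongr
    have h3 : (2 ^ m * y) ^ 2 = 4 ^ m * y ^ 2 := by
      rw [mul_pow, ← pow_mul, mul_comm m 2, pow_mul]; norm_num
    rw [h3] at h2
    rw [hm, pow_succ]
    have h4 : (0 : ℝ) < 4 ^ m * y ^ 2 := by positivity
    calc y * ((t - x) ^ 2 + y ^ 2)⁻¹ ≤ y * (4 ^ m * y ^ 2)⁻¹ := by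
          gcongr
          nlinarith [sq_nonneg y]
      _ = 4 * (4 ^ m * 4)⁻¹ / y := by field_simp

/-- The Poisson mean is dominated by a geometric series of averages over dyadic dilates. -/
theorem lintegral_poisson_mul_le_tsum {u : ℝ → ENNReal} (hu : AEMeasurable u) (x : ℝ) {y : ℝ}
    (hy : 0 < y) :
    ∫⁻ t, ENNReal.ofReal (halfPlanePoisson (x + y * Complex.I) t) * u t ≤
      ∑' k : ℕ, ENNReal.ofReal (4 * (4 ^ k)⁻¹ / y) *
        ∫⁻ t in Metric.closedBall x (2 ^ k * y), u t := by
  have hm : ∀ k : ℕ, MeasurableSet (Metric.closedBall x (2 ^ k * y)) := fun k =>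
    Metric.isClosed_closedBall.measurableSet
  calc _ ≤ ∫⁻ t, ∑' k : ℕ, ENNReal.ofReal (4 * (4 ^ k)⁻¹ / y) *
        (Metric.closedBall x (2 ^ k * y)).indicator u t := by
        refine lintegral_mono fun t => ?_
        obtain ⟨k, hk, hle⟩ := halfPlanePoisson_le_dyadic x t hy
        refine le_trans ?_ (ENNReal.le_tsum k)
        rw [Set.indicator_of_mem hk]
        gcongr
    _ = _ := by
        rw [lintegral_tsum fun k => (hu.indicator (hm k)).const_mul _]
        refine tsum_congr fun k => ?_
        rw [lintegral_const_mul' _ _ ENNReal.ofReal_ne_top, lintegral_indicator (hm k)]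

/-- From ‖F‖ ≤ ‖F‖² + 1, square integrability bounds the averages over all large balls, where the
Lebesgue point condition says nothing. -/
theorem setAverage_norm_sub_le {F : ℝ → ℂ} (hF : MemLp F 2) (x : ℝ) {r₀ r : ℝ} (hr₀ : 0 < r₀)
    (hr : r₀ ≤ r) :
    ⨍ t in Metric.closedBall x r, ‖F t - F x‖ ≤
      (2 * r₀)⁻¹ * (∫ t, ‖F t‖ ^ 2) + (1 + ‖F x‖) := by
  have hr0 := hr₀.trans_le hr
  have h2 := (memLp_two_iff_integrable_sq_norm hF.1).1 hF
  have hvol : volume.real (Metric.closedBall x r) = 2 * r := by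
    rw [measureReal_def, Real.volume_closedBall, ENNReal.toReal_ofReal (by positivity)]
  have hc : IntegrableOn (fun _ : ℝ => (1 + ‖F x‖ : ℝ)) (Metric.closedBall x r) :=
    integrableOn_const measure_closedBall_lt_top.ne (by simp)
  have hle : ∫ t in Metric.closedBall x r, ‖F t - F x‖ ≤
      (∫ t, ‖F t‖ ^ 2) + 2 * r * (1 + ‖F x‖) := by
    calc ∫ t in Metric.closedBall x r, ‖F t - F x‖
        ≤ ∫ t in Metric.closedBall x r, (‖F t‖ ^ 2 + (1 + ‖F x‖)) := by
          refine integral_mono_of_nonneg (.of_forall fun t => norm_nonneg _)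
            (h2.integrableOn.add hc) (.of_forall fun t => ?_)
          have := norm_sub_le (F t) (F x)
          dsimp only
          nlinarith [sq_nonneg (‖F t‖ - 1)]
      _ = (∫ t in Metric.closedBall x r, ‖F t‖ ^ 2) + 2 * r * (1 + ‖F x‖) := by
          rw [integral_add h2.integrableOn hc, setIntegral_const, hvol, smul_eq_mul]
      _ ≤ _ := by
          gcongr
          · exact .of_forall fun t => by positivity
          · exact Measure.restrict_le_self
  rw [setAverage_eq, hvol, smul_eq_mul]
  have hI : 0 ≤ ∫ t, ‖F t‖ ^ 2 := integral_nonneg fun t => by positivity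
  calc (2 * r)⁻¹ * ∫ t in Metric.closedBall x r, ‖F t - F x‖
      ≤ (2 * r)⁻¹ * ((∫ t, ‖F t‖ ^ 2) + 2 * r * (1 + ‖F x‖)) := by gcongr
    _ = (2 * r)⁻¹ * (∫ t, ‖F t‖ ^ 2) + (1 + ‖F x‖) := by field_simp
    _ ≤ _ := by gcongr

/-- Poisson integrals of `L²` functions converge almost everywhere on vertical lines. -/
theorem ae_tendsto_poisson {F : ℝ → ℂ} (hF : MemLp F 2) :
    ∀ᵐ x : ℝ, Tendsto
      (fun y : ℝ => ∫ t : ℝ, (halfPlanePoisson (x + y * Complex.I) t : ℂ) * F t)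
      (𝓝[>] 0) (𝓝 (F x)) := by
  have hloc : LocallyIntegrable F := hF.locallyIntegrable one_le_two
  filter_upwards [IsUnifLocDoublingMeasure.ae_tendsto_average_norm_sub volume hloc 1] with x hx
  set A : ℝ → ℝ := fun r => ⨍ t in Metric.closedBall x r, ‖F t - F x‖ with hA
  have hA0 : ∀ r, 0 ≤ A r := fun r => by
    rw [hA]; dsimp only; rw [setAverage_eq]
    exact smul_nonneg (by positivity) (integral_nonneg fun t => norm_nonneg _)
  have hAlim : Tendsto A (𝓝[>] 0) (𝓝 0) := hx (fun _ => x) id tendsto_id (by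
    filter_upwards [self_mem_nhdsWithin] with r hr
    simpa using (Set.mem_Ioi.1 hr).le)
  obtain ⟨B, hB⟩ : ∃ B, ∀ r, 0 < r → A r ≤ B := by
    obtain ⟨r₀, hr₀, h1⟩ := mem_nhdsGT_iff_exists_Ioo_subset.1
      (hAlim (Iic_mem_nhds one_pos))
    refine ⟨max 1 ((2 * r₀)⁻¹ * (∫ t, ‖F t‖ ^ 2) + (1 + ‖F x‖)), fun r hr => ?_⟩
    rcases lt_or_ge r r₀ with h | h
    · exact (h1 ⟨hr, h⟩).trans (le_max_left _ _)
    · exact (setAverage_norm_sub_le hF x hr₀ h).trans (le_max_right _ _)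
  -- The coefficient is the kernel bound 4·4^(-k)/y times the ball's length 2·2^k·y. Every A(2^k y)
  -- tends to 0 and A is bounded, so dominated convergence for series gives S → 0.
  set S : ℝ → ℝ := fun y => ∑' k : ℕ, 8 * (1 / 2) ^ k * A (2 ^ k * y) with hS
  have hgeom : Summable fun k : ℕ => 8 * (1 / 2 : ℝ) ^ k * B :=
    (summable_geometric_two.mul_left 8).mul_right B
  have hbd : ∀ y : ℝ, 0 < y → ∀ k : ℕ, 8 * (1 / 2) ^ k * A (2 ^ k * y) ≤ 8 * (1 / 2 : ℝ) ^ k * B :=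
    fun y hy k => by
      have := hB (2 ^ k * y) (by positivity)
      gcongr
  have hnn : ∀ (y : ℝ) (k : ℕ), 0 ≤ 8 * (1 / 2) ^ k * A (2 ^ k * y) := fun y k =>
    mul_nonneg (by positivity) (hA0 _)
  have hSlim : Tendsto S (𝓝[>] 0) (𝓝 0) := by
    have : Tendsto S (𝓝[>] 0) (𝓝 (∑' k : ℕ, (0 : ℝ))) := by
      refine tendsto_tsum_of_dominated_convergence hgeom (fun k => ?_) ?_
      · have h1 : Tendsto (fun y : ℝ => 2 ^ k * y) (𝓝[>] 0) (𝓝[>] 0) := by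
          refine tendsto_nhdsWithin_iff.2 ⟨?_, ?_⟩
          · exact ((continuous_const.mul continuous_id).tendsto' _ _ (by simp)).mono_left
              nhdsWithin_le_nhds
          · filter_upwards [self_mem_nhdsWithin] with y hy
            exact mul_pos (pow_pos two_pos k) (Set.mem_Ioi.1 hy)
        simpa using (hAlim.comp h1).const_mul (8 * (1 / 2 : ℝ) ^ k)
      · filter_upwards [self_mem_nhdsWithin] with y hy k
        rw [Real.norm_of_nonneg (hnn y k)]
        exact hbd y hy k
    simpa using this
  rw [tendsto_iff_norm_sub_tendsto_zero]
  refine squeeze_zero' (.of_forall fun _ => norm_nonneg _) ?_ hSlim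
  filter_upwards [self_mem_nhdsWithin] with y hy
  have hy : 0 < y := hy
  have him : 0 < ((x : ℂ) + y * Complex.I).im := by simpa using hy
  have hsum : Summable fun k : ℕ => 8 * (1 / 2) ^ k * A (2 ^ k * y) :=
    hgeom.of_nonneg_of_le (hnn y) (hbd y hy)
  have hI1 : Integrable fun t : ℝ => (halfPlanePoisson (x + y * Complex.I) t : ℂ) * F t :=
    (memLp_two_halfPlanePoisson him).integrable_mul hF
  have hI2 : Integrable fun t : ℝ => (halfPlanePoisson (x + y * Complex.I) t : ℂ) * F x :=
    (integrable_halfPlanePoisson him).ofReal.mul_const _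
  have e : (∫ t : ℝ, (halfPlanePoisson (x + y * Complex.I) t : ℂ) * F t) - F x =
      ∫ t : ℝ, (halfPlanePoisson (x + y * Complex.I) t : ℂ) * (F t - F x) := by
    simp_rw [mul_sub]
    rw [integral_sub hI1 hI2, integral_mul_const, integral_complex_ofReal,
      integral_halfPlanePoisson him]
    simp
  rw [e, ← ENNReal.ofReal_le_ofReal_iff (tsum_nonneg (hnn y)), ofReal_norm,
    ENNReal.ofReal_tsum_of_nonneg (hnn y) hsum]
  calc _ ≤ ∫⁻ t : ℝ, ‖(halfPlanePoisson (x + y * Complex.I) t : ℂ) * (F t - F x)‖ₑ :=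
        enorm_integral_le_lintegral_enorm _
    _ = ∫⁻ t : ℝ, ENNReal.ofReal (halfPlanePoisson (x + y * Complex.I) t) * ‖F t - F x‖ₑ :=
        lintegral_congr fun t => by rw [enorm_mul, enorm_halfPlanePoisson him]
    _ ≤ _ := lintegral_poisson_mul_le_tsum (u := fun t => ‖F t - F x‖ₑ)
        (hF.1.sub aestronglyMeasurable_const).enorm x hy
    _ = _ := by
        refine tsum_congr fun k => ?_
        have hr : 0 < 2 ^ k * y := by positivity
        have hint : IntegrableOn (fun t => F t - F x) (Metric.closedBall x (2 ^ k * y)) :=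
          (hloc.integrableOn_isCompact (isCompact_closedBall _ _)).sub
            (integrableOn_const measure_closedBall_lt_top.ne (by simp))
        have hvol : volume.real (Metric.closedBall x (2 ^ k * y)) = 2 * (2 ^ k * y) := by
          rw [measureReal_def, Real.volume_closedBall, ENNReal.toReal_ofReal (by positivity)]
        have hAe : A (2 ^ k * y) = (2 * (2 ^ k * y))⁻¹ *
            ∫ t in Metric.closedBall x (2 ^ k * y), ‖F t - F x‖ := by
          rw [hA]; dsimp only; rw [setAverage_eq, hvol, smul_eq_mul]
        simp_rw [← ofReal_norm]
        rw [← ofReal_integral_eq_lintegral_ofReal hint.norm (.of_forall fun t => norm_nonneg _),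
          ← ENNReal.ofReal_mul (by positivity), hAe]
        congr 1
        have h4 : (4 : ℝ) ^ k = 2 ^ k * 2 ^ k := by rw [← mul_pow]; norm_num
        rw [h4, one_div, inv_pow]
        field_simp
        ring

/-- Fatou's theorem for the Hardy space of the half-plane. -/
theorem ae_exists_tendsto_vertical {h : ℂ → ℂ}
    (hd : DifferentiableOn ℂ h {z | 0 < z.im})
    (hb : ∀ δ > 0, ∃ M, ∀ z : ℂ, δ ≤ z.im → ‖h z‖ ≤ M) {C : NNReal}
    (hC : ∀ y : ℝ, 0 < y → ∫⁻ x : ℝ, ‖h (x + y * Complex.I)‖ₑ ^ 2 ≤ C) :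
    ∀ᵐ x : ℝ, ∃ l, Tendsto (fun y : ℝ => h (x + y * Complex.I)) (𝓝[>] 0) (𝓝 l) := by
  obtain ⟨F, hF, hP⟩ := exists_memLp_two_poisson_eq hd hb hC
  filter_upwards [ae_tendsto_poisson hF] with x hx
  refine ⟨F x, hx.congr' ?_⟩
  filter_upwards [self_mem_nhdsWithin] with y hy
  exact hP _ (by simpa using hy)

/-! ### Measurability of the convergence set -/

/-- Closed balls pass from the dense rational parameters to all parameters by continuity. This
reduces convergence to a countable family, for which the convergence set is measurable. -/
theorem tendsto_nhdsGT_zero_of_tendsto_rat {G : ℝ → ℂ} (hG : ContinuousOn G (Set.Ioi 0)) {l : ℂ}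
    (h : Tendsto (fun q : {q : ℚ // 0 < q} => G (q : ℚ))
      (comap (fun q : {q : ℚ // 0 < q} => ((q : ℚ) : ℝ)) (𝓝[>] 0)) (𝓝 l)) :
    Tendsto G (𝓝[>] 0) (𝓝 l) := by
  rw [Metric.nhds_basis_closedBall.tendsto_right_iff] at h ⊢
  intro ε hε
  obtain ⟨s, hs, hs'⟩ := mem_comap.1 (h ε hε)
  obtain ⟨δ, hδ, hδs⟩ := mem_nhdsGT_iff_exists_Ioo_subset.1 hs
  filter_upwards [Ioo_mem_nhdsGT (Set.mem_Ioi.1 hδ)] with y hy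
  have hcl : y ∈ closure (Set.Ioo 0 δ ∩ Set.range ((↑) : ℚ → ℝ)) :=
    (Rat.denseRange_cast (𝕜 := ℝ)).open_subset_closure_inter isOpen_Ioo hy
  have hcont : ContinuousWithinAt G (Set.Ioo 0 δ ∩ Set.range ((↑) : ℚ → ℝ)) y :=
    ((hG y hy.1).mono fun z hz => hz.1.1)
  have := hcont.mem_closure hcl (t := Metric.closedBall l ε) (by
    rintro _ ⟨hz, q, rfl⟩
    have hq : 0 < q := by exact_mod_cast hz.1
    exact hs' (a := ⟨q, hq⟩) (hδs hz))
  rwa [Metric.isClosed_closedBall.closure_eq] at this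

/-- The set of points where a continuous one-parameter family converges is measurable. -/
theorem measurableSet_exists_tendsto_nhdsGT {X : Type*} [MeasurableSpace X] {G : X → ℝ → ℂ}
    (hc : ∀ x, ContinuousOn (G x) (Set.Ioi 0)) (hm : ∀ y, 0 < y → Measurable fun x => G x y) :
    MeasurableSet {x | ∃ l, Tendsto (G x) (𝓝[>] 0) (𝓝 l)} := by
  have h := measurableSet_exists_tendsto
    (l := comap (fun q : {q : ℚ // 0 < q} => ((q : ℚ) : ℝ)) (𝓝[>] 0))
    (f := fun (q : {q : ℚ // 0 < q}) x => G x (q : ℚ))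
    (fun q => hm _ (by exact_mod_cast q.2))
  convert! h using 3 with x
  exact exists_congr fun l => ⟨fun hl => hl.comp tendsto_comap,
    tendsto_nhdsGT_zero_of_tendsto_rat (hc x)⟩

/-! ### Diagonal slices and boundary values -/

section Slices

variable {f : ℂ × ℂ → ℂ}

theorem differentiableOn_slice (hf : f ∈ hardySpace) (c : ℝ) :
    DifferentiableOn ℂ (fun z : ℂ => f (z, z + c)) {z | 0 < z.im} :=
  hf.1.differentiableOn.comp (f := fun z : ℂ => (z, z + c)) (by fun_prop) fun z hz =>
    ⟨hz, by simpa using hz⟩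

theorem bounded_slice (hf : f ∈ hardySpace) (c : ℝ) :
    ∀ δ > 0, ∃ M, ∀ z : ℂ, δ ≤ z.im → ‖f (z, z + c)‖ ≤ M := fun δ hδ => by
  obtain ⟨M, hM⟩ := hardySpace_bounded hf hδ
  exact ⟨M, fun z hz => hM _ hz (by simpa using hz)⟩

theorem continuous_tubePoint_left (hf : f ∈ hardySpace) {y : ℝ} (hy : 0 < y) :
    Continuous fun x : ℝ × ℝ => f (tubePoint x (y, y)) :=
  hf.1.continuousOn.comp_continuous (by unfold tubePoint; fun_prop) fun _ => tubePoint_mem hy hy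

theorem measurePreserving_shear :
    MeasurePreserving (fun p : ℝ × ℝ => (p.2, p.2 + p.1)) :=
  measurePreserving_prod_add_swap volume volume

theorem slice_eq (c s y : ℝ) : f ((s : ℂ) + y * Complex.I, (s : ℂ) + y * Complex.I + c) =
    f (tubePoint (s, s + c) (y, y)) := by
  unfold tubePoint
  congr 2
  push_cast
  ring

/-- Integrated over c, the slice means at any height are at most the Hardy bound. They increase as
the height falls, so by monotone convergence their supremum is integrable in c, hence finite for
almost every c. -/
theorem ae_exists_slice_bound (hf : f ∈ hardySpace) :
    ∀ᵐ c : ℝ, ∃ C : NNReal, ∀ y : ℝ, 0 < y →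
      ∫⁻ s : ℝ, ‖f ((s : ℂ) + y * Complex.I, (s : ℂ) + y * Complex.I + c)‖ₑ ^ 2 ≤ C := by
  obtain ⟨C, hC⟩ := hf.2
  -- The heights 1/(n + 1) decrease to 0, so u increases in n and its supremum dominates the mean at
  -- every height.
  set u : ℕ → ℝ → ENNReal := fun n c => ∫⁻ s : ℝ,
    ‖f (tubePoint (s, s + c) (1 / ((n : ℝ) + 1), 1 / ((n : ℝ) + 1)))‖ₑ ^ 2 with hu
  have hpos : ∀ n : ℕ, (0 : ℝ) < 1 / ((n : ℝ) + 1) := fun n => by positivity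
  have hjm : ∀ n : ℕ, Measurable fun p : ℝ × ℝ =>
      ‖f (tubePoint (p.2, p.2 + p.1) (1 / ((n : ℝ) + 1), 1 / ((n : ℝ) + 1)))‖ₑ ^ 2 := fun n =>
    ((continuous_tubePoint_left hf (hpos n)).measurable.comp
      measurePreserving_shear.measurable).enorm.pow_const 2
  have hum : ∀ n, Measurable (u n) := fun n => (hjm n).lintegral_prod_right'
  have hanti : ∀ (c : ℝ) {a b : ℝ}, 0 < a → a ≤ b →
      ∫⁻ s : ℝ, ‖f (tubePoint (s, s + c) (b, b))‖ₑ ^ 2 ≤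
        ∫⁻ s : ℝ, ‖f (tubePoint (s, s + c) (a, a))‖ₑ ^ 2 := fun c a b ha hab => by
    simp_rw [← slice_eq]
    exact lintegral_enorm_sq_line_antitone (differentiableOn_slice hf c) (bounded_slice hf c) ha hab
  have hmono : Monotone u := fun m n hmn c =>
    hanti c (hpos n) (one_div_le_one_div_of_le (by positivity) (by gcongr))
  have hint : ∀ n, ∫⁻ c, u n c ≤ C := fun n => by
    have h1 := measurePreserving_shear.lintegral_comp
      ((continuous_tubePoint_left hf (hpos n)).measurable.enorm.pow_const 2)
    rw [Measure.volume_eq_prod, lintegral_prod _ (hjm n).aemeasurable] at h1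
    exact h1.le.trans (hC (_, _) (hpos n) (hpos n))
  have hsup : ∫⁻ c, ⨆ n, u n c ≤ C := by
    rw [lintegral_iSup hum hmono]
    exact iSup_le hint
  filter_upwards [ae_lt_top (Measurable.iSup hum) (hsup.trans_lt ENNReal.coe_lt_top).ne] with c hc
  refine ⟨(⨆ n, u n c).toNNReal, fun y hy => ?_⟩
  rw [ENNReal.coe_toNNReal hc.ne]
  obtain ⟨n, hn⟩ := exists_nat_one_div_lt hy
  simp_rw [slice_eq]
  exact (hanti c (hpos n) hn.le).trans (le_iSup (fun n => u n c) n)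

/-- Functions in the Hardy space have boundary values almost everywhere. -/
theorem ae_hasBoundaryValue (hf : f ∈ hardySpace) :
    ∀ᵐ t : ℝ × ℝ, HasBoundaryValue f t (boundaryFunction f t) := by
  have hcy : ∀ x : ℝ × ℝ, ContinuousOn (fun y : ℝ => f (tubePoint x (y, y))) (Set.Ioi 0) :=
    fun x => hf.1.continuousOn.comp (by unfold tubePoint; fun_prop) fun y hy => tubePoint_mem hy hy
  have hmeas := measurableSet_exists_tendsto_nhdsGT hcy
    fun y hy => (continuous_tubePoint_left hf hy).measurable
  have h1 : ∀ᵐ p : ℝ × ℝ, ∃ l, Tendsto (fun y : ℝ => f (tubePoint (p.2, p.2 + p.1) (y, y)))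
      (𝓝[>] 0) (𝓝 l) := by
    rw [Measure.volume_eq_prod]
    -- Passing from almost every slice to almost every point of the plane requires the convergence
    -- set to be measurable.
    refine (Measure.ae_prod_iff_ae_ae (measurePreserving_shear.measurable hmeas)).2 ?_
    filter_upwards [ae_exists_slice_bound hf] with c ⟨C, hC⟩
    simp_rw [← slice_eq]
    exact ae_exists_tendsto_vertical (differentiableOn_slice hf c) (bounded_slice hf c) hC
  have h2 : ∀ᵐ x : ℝ × ℝ, ∃ l, Tendsto (fun y : ℝ => f (tubePoint x (y, y))) (𝓝[>] 0) (𝓝 l) := by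
    rw [← measurePreserving_shear.map_eq,
      ae_map_iff measurePreserving_shear.measurable.aemeasurable hmeas]
    exact h1
  exact h2.mono fun x hx => tendsto_nhds_limUnder hx

end Slices

/-! ### Weak convergence and the Cauchy formula -/

/-- An `L²`-bounded sequence converging almost everywhere converges weakly in `L²`. -/
theorem tendsto_integral_mul_of_ae_tendsto {X : Type*} [MeasurableSpace X] {μ : Measure X}
    {u : ℕ → X → ℂ} {v g : X → ℂ} (hum : ∀ n, AEStronglyMeasurable (u n) μ) {C : NNReal}
    (hC : ∀ n, ∫⁻ x, ‖u n x‖ₑ ^ 2 ∂μ ≤ C)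
    (hlim : ∀ᵐ x ∂μ, Tendsto (fun n => u n x) atTop (𝓝 (v x))) (hg : MemLp g 2 μ) :
    MemLp v 2 μ ∧ Tendsto (fun n => ∫ x, g x * u n x ∂μ) atTop (𝓝 (∫ x, g x * v x ∂μ)) := by
  have hvm : AEStronglyMeasurable v μ := aestronglyMeasurable_of_tendsto_ae atTop hum hlim
  have hvC : ∫⁻ x, ‖v x‖ₑ ^ 2 ∂μ ≤ C := by
    calc ∫⁻ x, ‖v x‖ₑ ^ 2 ∂μ = ∫⁻ x, liminf (fun n => ‖u n x‖ₑ ^ 2) atTop ∂μ := by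
          refine lintegral_congr_ae (hlim.mono fun x hx => ?_)
          exact ((((ENNReal.continuous_pow 2).tendsto _).comp hx.enorm).liminf_eq).symm
      _ ≤ liminf (fun n => ∫⁻ x, ‖u n x‖ₑ ^ 2 ∂μ) atTop :=
          lintegral_liminf_le' fun n => (hum n).enorm.pow_const 2
      _ ≤ C := liminf_le_of_le (by isBoundedDefault) fun b hb => by
          obtain ⟨n, hn⟩ := hb.exists
          exact hn.trans (hC n)
  have hv := (memLp_two_of_lintegral_le hvm hvC).1
  have hu := fun n => (memLp_two_of_lintegral_le (hum n) (hC n)).1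
  refine ⟨hv, ?_⟩
  have hd : ∀ n, MemLp (fun x => u n x - v x) 2 μ := fun n => (hu n).sub hv
  have hd2 : ∀ n, Integrable (fun x => ‖u n x - v x‖ ^ 2) μ := fun n =>
    (memLp_two_iff_integrable_sq_norm (hd n).1).1 (hd n)
  have hg2 : Integrable (fun x => ‖g x‖ ^ 2) μ := (memLp_two_iff_integrable_sq_norm hg.1).1 hg
  have hreal : ∀ w : X → ℂ, AEStronglyMeasurable w μ → ∫⁻ x, ‖w x‖ₑ ^ 2 ∂μ ≤ C →
      ∫ x, ‖w x‖ ^ 2 ∂μ ≤ C := fun w hw hwC => by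
    rw [integral_eq_lintegral_of_nonneg_ae (.of_forall fun x => by positivity)
      (continuous_pow 2 |>.comp_aestronglyMeasurable hw.norm)]
    refine ENNReal.toReal_le_of_le_ofReal C.2 ?_
    rw [ENNReal.ofReal_coe_nnreal]
    refine le_trans (le_of_eq (lintegral_congr fun x => ?_)) hwC
    rw [ENNReal.ofReal_pow (norm_nonneg _), ofReal_norm]
  have hD : ∀ n, ∫ x, ‖u n x - v x‖ ^ 2 ∂μ ≤ 4 * C := fun n => by
    have hu2 := (memLp_two_iff_integrable_sq_norm (hu n).1).1 (hu n)
    have hv2 := (memLp_two_iff_integrable_sq_norm hv.1).1 hv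
    calc ∫ x, ‖u n x - v x‖ ^ 2 ∂μ ≤ ∫ x, (2 * ‖u n x‖ ^ 2 + 2 * ‖v x‖ ^ 2) ∂μ := by
          refine integral_mono (hd2 n) ((hu2.const_mul 2).add (hv2.const_mul 2)) fun x => ?_
          have h1 := norm_sub_le (u n x) (v x)
          have h2 : ‖u n x - v x‖ ^ 2 ≤ (‖u n x‖ + ‖v x‖) ^ 2 := by gcongr
          dsimp only
          nlinarith [sq_nonneg (‖u n x‖ - ‖v x‖)]
      _ = 2 * (∫ x, ‖u n x‖ ^ 2 ∂μ) + 2 * ∫ x, ‖v x‖ ^ 2 ∂μ := by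
          rw [integral_add (hu2.const_mul 2) (hv2.const_mul 2), integral_const_mul,
            integral_const_mul]
      _ ≤ 4 * C := by
          have := hreal _ (hum n) (hC n)
          have := hreal _ hvm hvC
          linarith
  -- With a = ‖u n - v‖ and b = ‖g‖, one has ab ≤ min(ab, Kb²) + a²/K, splitting at a = Kb. The
  -- minimum is dominated by the integrable Kb²; the remainder is uniformly small for large K.
  have hmain : ∀ (K : ℝ), 0 < K → ∀ n, ‖(∫ x, g x * u n x ∂μ) - ∫ x, g x * v x ∂μ‖ ≤
      (∫ x, min (‖u n x - v x‖ * ‖g x‖) (K * ‖g x‖ ^ 2) ∂μ) + 4 * C / K := fun K hK n => by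
    have hmin : Integrable (fun x => min (‖u n x - v x‖ * ‖g x‖) (K * ‖g x‖ ^ 2)) μ :=
      ((hd n).norm.integrable_mul hg.norm).inf (hg2.const_mul K)
    have hgu : Integrable (fun x => g x * u n x) μ := hg.integrable_mul (hu n)
    have hgv : Integrable (fun x => g x * v x) μ := hg.integrable_mul hv
    rw [← integral_sub hgu hgv]
    calc _ ≤ ∫ x, (min (‖u n x - v x‖ * ‖g x‖) (K * ‖g x‖ ^ 2) + K⁻¹ * ‖u n x - v x‖ ^ 2) ∂μ := by
          refine norm_integral_le_of_norm_le (hmin.add ((hd2 n).const_mul _))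
            (.of_forall fun x => ?_)
          have e : ‖g x * u n x - g x * v x‖ = ‖u n x - v x‖ * ‖g x‖ := by
            rw [← mul_sub, norm_mul, mul_comm]
          rw [e]
          rcases le_total ‖u n x - v x‖ (K * ‖g x‖) with h | h
          · rw [min_eq_left (by nlinarith [norm_nonneg (g x)])]
            have : 0 ≤ K⁻¹ * ‖u n x - v x‖ ^ 2 := by positivity
            linarith
          · have h1 : 0 ≤ min (‖u n x - v x‖ * ‖g x‖) (K * ‖g x‖ ^ 2) := by positivity
            have h2 : ‖u n x - v x‖ * ‖g x‖ ≤ K⁻¹ * ‖u n x - v x‖ ^ 2 := by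
              rw [inv_mul_eq_div, le_div_iff₀ hK]
              nlinarith [norm_nonneg (u n x - v x)]
            linarith
      _ = (∫ x, min (‖u n x - v x‖ * ‖g x‖) (K * ‖g x‖ ^ 2) ∂μ) +
            K⁻¹ * ∫ x, ‖u n x - v x‖ ^ 2 ∂μ := by
          rw [integral_add hmin ((hd2 n).const_mul _), integral_const_mul]
      _ ≤ _ := by
          rw [div_eq_inv_mul]
          have := hD n
          gcongr
  have hDCT : ∀ (K : ℝ), 0 < K →
      Tendsto (fun n => ∫ x, min (‖u n x - v x‖ * ‖g x‖) (K * ‖g x‖ ^ 2) ∂μ) atTop (𝓝 0) :=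
    fun K hK => by
      have : Tendsto (fun n => ∫ x, min (‖u n x - v x‖ * ‖g x‖) (K * ‖g x‖ ^ 2) ∂μ) atTop
          (𝓝 (∫ _, (0 : ℝ) ∂μ)) := by
        refine tendsto_integral_of_dominated_convergence (fun x => K * ‖g x‖ ^ 2) (fun n => ?_)
          (hg2.const_mul K) (fun n => .of_forall fun x => ?_) (hlim.mono fun x hx => ?_)
        · exact (((hd n).norm.integrable_mul hg.norm).inf (hg2.const_mul K)).aestronglyMeasurable
        · rw [Real.norm_of_nonneg (by positivity)]
          exact min_le_right _ _
        · have h0 : Tendsto (fun n => ‖u n x - v x‖ * ‖g x‖) atTop (𝓝 0) := by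
            simpa using (tendsto_iff_norm_sub_tendsto_zero.1 hx).mul_const ‖g x‖
          have := h0.min (tendsto_const_nhds (x := K * ‖g x‖ ^ 2))
          rwa [min_eq_left (by positivity)] at this
      simpa using this
  rw [Metric.tendsto_atTop']
  intro ε hε
  -- This makes 4C/K ≤ ε/2; adding 1 to C keeps K positive when C = 0.
  set K : ℝ := 8 * (C + 1) / ε with hK
  have hC0 : (0 : ℝ) ≤ C := C.2
  have hK0 : 0 < K := by positivity
  obtain ⟨N, hN⟩ := eventually_atTop.1 ((hDCT K hK0).eventually (gt_mem_nhds (half_pos hε)))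
  refine ⟨N, fun n hn => ?_⟩
  rw [dist_eq_norm]
  refine (hmain K hK0 n).trans_lt ?_
  have h1 : 4 * C / K ≤ ε / 2 := by
    rw [hK, div_le_iff₀ (by positivity)]
    field_simp
    nlinarith
  linarith [hN n hn.le]

theorem cauchyIntegrand_eq (g : ℝ × ℝ → ℂ) (w : ℂ × ℂ) (t : ℝ × ℝ) :
    cauchyIntegrand g w t = 1 / ((t.1 : ℂ) - w.1) * (1 / ((t.2 : ℂ) - w.2)) * g t := by
  rw [cauchyIntegrand, one_div_mul_one_div, one_div, div_eq_inv_mul]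

/-- The Cauchy formula for the Hardy space. -/
theorem cauchyIntegral_boundaryFunction {f : ℂ × ℂ → ℂ} (hf : f ∈ hardySpace) {w : ℂ × ℂ}
    (hw : w ∈ biHalfPlane) :
    Integrable (cauchyIntegrand (boundaryFunction f) w) ∧
      cauchyIntegral (boundaryFunction f) w = f w := by
  obtain ⟨C, hC⟩ := hf.2
  set ε : ℕ → ℝ := fun n => 1 / ((n : ℝ) + 1) with hε
  have hpos : ∀ n, 0 < ε n := fun n => by positivity
  have hε0 : Tendsto ε atTop (𝓝[>] 0) :=
    tendsto_nhdsWithin_iff.2 ⟨tendsto_one_div_add_atTop_nhds_zero_nat, .of_forall hpos⟩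
  have hker := memLp_two_cauchyKernel hw.1.ne' hw.2.ne'
  have hum : ∀ n, AEStronglyMeasurable (fun t : ℝ × ℝ => f (tubePoint t (ε n, ε n))) volume :=
    fun n => (continuous_tubePoint_left hf (hpos n)).aestronglyMeasurable
  have hCn := fun n => hC (ε n, ε n) (hpos n) (hpos n)
  obtain ⟨hv, hlim⟩ := tendsto_integral_mul_of_ae_tendsto hum hCn
    ((ae_hasBoundaryValue hf).mono fun t ht =>
      Tendsto.comp (g := fun y : ℝ => f (tubePoint t (y, y))) ht hε0) hker
  refine ⟨?_, ?_⟩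
  · simp_rw [funext (cauchyIntegrand_eq (boundaryFunction f) w)]
    exact hker.integrable_mul hv
  · rw [cauchyIntegral]
    simp_rw [cauchyIntegrand_eq]
    refine tendsto_nhds_unique (hlim.const_mul (1 / (2 * (Real.pi : ℂ) * Complex.I) ^ 2)) ?_
    have hshift : ∀ n, 1 / (2 * (Real.pi : ℂ) * Complex.I) ^ 2 * ∫ t : ℝ × ℝ,
        1 / ((t.1 : ℂ) - w.1) * (1 / ((t.2 : ℂ) - w.2)) * f (tubePoint t (ε n, ε n)) =
        f (w.1 + ε n * Complex.I, w.2 + ε n * Complex.I) := fun n => by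
      obtain ⟨M, hM⟩ := hardySpace_bounded hf (hpos n)
      -- The upward translate is analytic on imaginary parts above -ε n and bounded on the closed
      -- domain.
      exact integral_cauchyKernel_mul_eq
        (f := fun z => f (z.1 + ε n * Complex.I, z.2 + ε n * Complex.I)) (δ := -ε n) (M := M)
        (by linarith [hpos n])
        (hf.1.differentiableOn.comp
          (f := fun z : ℂ × ℂ => (z.1 + ε n * Complex.I, z.2 + ε n * Complex.I))
          (by fun_prop) fun z hz => by
            obtain ⟨h1, h2⟩ := hz
            constructor <;> simp <;> linarith)
        (fun z h1 h2 => hM _ (by simpa using h1) (by simpa using h2))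
        (memLp_two_of_lintegral_le (hum n) (hCn n)).1 hw
    simp_rw [hshift]
    have hcw : ContinuousAt f w := (hf.1 w hw).continuousAt
    have : Tendsto (fun y : ℝ => (w.1 + y * Complex.I, w.2 + y * Complex.I)) (𝓝 0) (𝓝 w) :=
      (by fun_prop : Continuous fun y : ℝ =>
        (w.1 + y * Complex.I, w.2 + y * Complex.I)).tendsto' _ _ (by simp)
    exact hcw.tendsto.comp ((this.mono_left nhdsWithin_le_nhds).comp hε0)

/-! ### Boundary values of the composition -/

theorem proposition7 (φ : ℂ × ℂ → ℂ × ℂ)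
    (hφ : AnalyticOnNhd ℂ φ biHalfPlane) (hmaps : Set.MapsTo φ biHalfPlane biHalfPlane)
    (hlim : ∀ᵐ x : ℝ × ℝ, HasBoundaryValue φ x (boundaryFunction φ x))
    (him : ∀ᵐ x : ℝ × ℝ,
      0 < (boundaryFunction φ x).1.im ∧ 0 < (boundaryFunction φ x).2.im)
    (f : ℂ × ℂ → ℂ) (hf : f ∈ hardySpace) :
    (∀ᵐ t : ℝ × ℝ, HasBoundaryValue f t (boundaryFunction f t)) ∧
    ∀ᵐ x : ℝ × ℝ,
      HasBoundaryValue (compositionOperator φ f) x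
        (boundaryFunction (compositionOperator φ f) x) ∧
      Integrable (cauchyIntegrand (boundaryFunction f) (boundaryFunction φ x)) ∧
      boundaryFunction (compositionOperator φ f) x =
        cauchyIntegral (boundaryFunction f) (boundaryFunction φ x) := by
  refine ⟨ae_hasBoundaryValue hf, ?_⟩
  filter_upwards [hlim, him] with x hx hw
  obtain ⟨hint, hval⟩ := cauchyIntegral_boundaryFunction hf hw
  -- Because φ*(x) is an interior point, any way in which φ approaches it will do; only continuity
  -- of f there is used.
  have h : HasBoundaryValue (compositionOperator φ f) x (f (boundaryFunction φ x)) :=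
    (hf.1 _ hw).continuousAt.tendsto.comp hx
  have he : boundaryFunction (compositionOperator φ f) x = f (boundaryFunction φ x) := h.limUnder_eq
  exact ⟨by rw [he]; exact h, hint, by rw [he, hval]⟩
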